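/- Let $G$ be a finite connected multigraph with oriented edges $e\colon e^-\to e^+$, let $\ell\colon E(G)\to\mathbb{R}_{>0}$, and let $C$ be the tropical curve (metric graph) with model $(G,\ell)$. Let $H_1=H_1(G,\mathbb{Z})\subset C_1(G,\mathbb{Z})=\mathbb{Z}^{E(G)}$, $N=\operatorname{Hom}(H_1,\mathbb{Z})$, and $N_A=A\otimes N=\operatorname{Hom}(H_1,A)$ for a commutative ring $A$. Given $x\colon E(G)\to A$, let $[\cdot,\cdot]$ be the bilinear pairing on $C_1(G,\mathbb{Z})$ with $[e,e]=x_e$ and $[e,e']=0$ for $e\ne e'$; set $\pi(c)=[c,\cdot]\in N_A$, and let $n_e\in N$ be the functional "coefficient at $e$", so that $\pi(e)=x_en_e$. *Universal side.* Let $R=\mathbb{Z}[x_e\mid e\in E(G)]$, $A=R$, and $\Lambda=\pi(H_1)\subset N_R$. Let $C_q$ be the free abelian group on the ordered simplices $(u_0,\dots,u_q)\in N_R^{q+1}$ modulo simultaneous translation by elements of $\Lambda$, with the usual boundary $\partial$, and let $C_{1,q}=N\otimes C_q$. Define $\Theta\colon C_{1,2}\to\bigwedge^3_RN_R$ by $\Theta(n\otimes(u_0,u_1,u_2))=n\wedge(u_1-u_0)\wedge(u_2-u_0)$,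 and let $\mathscr{P}$ be the image under $\Theta$ of the cycles in $C_{1,2}$. For a vertex $v$ let $$\mathrm{Cer}_v(G)=\sum_en_e\otimes\big((\pi(\delta_e),\pi(\delta_e+e))+(-\pi(\delta_e),-\pi(\delta_e+e))\big)\in C_{1,1},$$ where $\delta_e$ is a path from $v$ to $e^-$. The universal Ceresa period $\alpha(G)$ is the class of $\Theta(\Sigma)$ in $\bigwedge^3_RN_R/\mathscr{P}$ for any $\Sigma\in C_{1,2}$ with $\partial\Sigma=\mathrm{Cer}_v(G)$. *Tropical side.* Take $A=\mathbb{R}$, $x=\ell$, write $\pi_C$ for the corresponding map $\pi$, and put $\Lambda_C=\pi_C(H_1)\subset N_{\mathbb{R}}$ and $\mathrm{Jac}(C)=N_{\mathbb{R}}/\Lambda_C$. Let $S_\bullet$ be the complex of smooth singular chains of $\mathrm{Jac}(C)$ and $S_{1,q}=N\otimes S_q$. Choose a basis $\epsilon_1,\dots,\epsilon_g$ of $N$, with associated coordinates $z_1,\dots,z_g$ on $N_{\mathbb{R}}$, and define $\Theta_C\colon S_{1,2}\to\bigwedge^3_{\mathbb{R}}N_{\mathbb{R}}$ by $$\Theta_C(n\otimes\sigma)=2\sum_{i<j<k}\Big(\int_\sigma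 n_i\,dz_j\wedge dz_k-n_j\,dz_i\wedge dz_k+n_k\,dz_i\wedge dz_j\Big)\,\epsilon_i\wedge\epsilon_j\wedge\epsilon_k .$$ Let $\mathscr{P}_C$ be the image under $\Theta_C$ of the cycles in $S_{1,2}$. For a point $p\in C$, let $\mathrm{Cer}_p(C)\in S_{1,1}$ be given by the formula above with $\pi_C$ in place of $\pi$ and with affine simplices of $\mathrm{Jac}(C)$, the sum being over the edges of $G$ after subdividing, if necessary, the edge containing $p$ in its interior (so that $p$ becomes a vertex), and $\delta_e$ being a path from $p$ to $e^-$. The Ceresa period $\alpha(C)$ is the class of $\Theta_C(\Sigma)$ in $\bigwedge^3_{\mathbb{R}}N_{\mathbb{R}}/\mathscr{P}_C$ for any $\Sigma\in S_{1,2}$ with $\partial\Sigma=\mathrm{Cer}_p(C)$. Let $\mathrm{ev}$ denote the ring map $R\to\mathbb{R}$, $x_e\mapsto\ell(e)$, and the induced maps $N_R\to N_{\mathbb{R}}$ and $\bigwedge^3_RN_R\to\bigwedge^3_{\mathbb{R}}N_{\mathbb{R}}$. **Proposition.** For all base points $v\in V(G)$ and $p\in C$, chains $\Sigma$ as above exist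 on both sides. Moreover $\mathrm{ev}(\mathscr{P})=\mathscr{P}_C$, and the induced map $\bigwedge^3_RN_R/\mathscr{P}\to\bigwedge^3_{\mathbb{R}}N_{\mathbb{R}}/\mathscr{P}_C$ sends $\alpha(G)$ to $\alpha(C)$, for every choice of the base points $v$ and $p$. In particular, if $\alpha(G)=0$, then $\alpha(C)=0$. -/

import Mathlib

open scoped TensorProduct ContDiff

noncomputable section

namespace Ceresa

/-! ### Exterior powers under a change of the base ring -/

/-- A semilinear map `f : M → M'` over a ring map `φ : A → B` induces a semilinear map of
exterior powers, `v₁ ∧ ⋯ ∧ vₖ ↦ f v₁ ∧ ⋯ ∧ f vₖ`. -/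
def extMap {A B : Type*} [CommRing A] [CommRing B] (φ : A →+* B) {M M' : Type*}
    [AddCommGroup M] [Module A M] [AddCommGroup M'] [Module B M'] (k : ℕ) (f : M →ₛₗ[φ] M') :
    ⋀[A]^k M →ₛₗ[φ] ⋀[B]^k M' :=
  letI : Module A (⋀[B]^k M') := Module.compHom _ φ
  let a : M [⋀^Fin k]→ₗ[A] ⋀[B]^k M' :=
    { toFun := fun v => exteriorPower.ιMulti B k (fun i => f (v i))
      map_update_add' := by
        intro _ m i x y
        have h : ∀ z : M, (fun j => f (Function.update m i z j))
            = Function.update (fun j => f (m j)) i (f z) := by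
          intro z; ext j; by_cases hj : j = i
          · subst hj; simp
          · simp [hj]
        simp only [h, map_add, AlternatingMap.map_update_add]
      map_update_smul' := by
        intro _ m i c x
        have h : ∀ z : M, (fun j => f (Function.update m i z j))
            = Function.update (fun j => f (m j)) i (f z) := by
          intro z; ext j; by_cases hj : j = i
          · subst hj; simp
          · simp [hj]
        simp only [h, map_smulₛₗ, AlternatingMap.map_update_smul]
        rfl
      map_eq_zero_of_eq' := by
        intro v i j hv hij
        exact AlternatingMap.map_eq_zero_of_eq _ _ (by simp [hv]) hij }
  { toFun := exteriorPower.alternatingMapLinearEquiv a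
    map_add' := fun x y => map_add _ x y
    map_smul' := fun c x => LinearMap.map_smul (exteriorPower.alternatingMapLinearEquiv a) c x }

theorem extMap_ιMulti {A B : Type*} [CommRing A] [CommRing B] (φ : A →+* B) {M M' : Type*}
    [AddCommGroup M] [Module A M] [AddCommGroup M'] [Module B M'] (k : ℕ) (f : M →ₛₗ[φ] M')
    (v : Fin k → M) :
    extMap φ k f (exteriorPower.ιMulti A k v) = exteriorPower.ιMulti B k (fun i => f (v i)) := by
  let _ : Module A (⋀[B]^k M') := Module.compHom _ φ
  exact exteriorPower.alternatingMapLinearEquiv_apply_ιMulti _ _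

/-- `a ∧ b ∧ c` in the third exterior power. -/
def wedge (A : Type*) [CommRing A] {M : Type*} [AddCommGroup M] [Module A M] (a b c : M) :
    ⋀[A]^3 M :=
  exteriorPower.ιMulti A 3 ![a, b, c]

/-! ### Graphs, their homology, and the length pairing -/

/-- A connected multigraph (loops and parallel edges allowed) with a chosen orientation:
`e` runs from `tail e` (the vertex `e⁻`) to `head e` (the vertex `e⁺`). -/
structure MGraph (V E : Type*) where
  tail : E → V
  head : E → V
  nonempty : Nonempty V
  connected : ∀ v w : V, Relation.EqvGen (fun a b => ∃ e, tail e = a ∧ head e = b) v w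

namespace MGraph

variable {V E : Type*} (G : MGraph V E)

/-- The boundary `C₁(G, ℤ) → C₀(G, ℤ)`, `e ↦ e⁺ - e⁻`. -/
def bdry : (E →₀ ℤ) →ₗ[ℤ] (V →₀ ℤ) :=
  Finsupp.linearCombination ℤ
    (fun e => Finsupp.single (G.head e) (1 : ℤ) - Finsupp.single (G.tail e) 1)

/-- `H₁(G, ℤ) ⊆ C₁(G, ℤ)`. -/
def H1 : Submodule ℤ (E →₀ ℤ) := LinearMap.ker G.bdry

/-- `N = H¹(G, ℤ) = Hom(H₁(G, ℤ), ℤ)`. -/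
def N : Type _ := G.H1 →+ ℤ

instance : AddCommGroup G.N := inferInstanceAs (AddCommGroup (G.H1 →+ ℤ))

instance : FunLike G.N G.H1 ℤ := inferInstanceAs (FunLike (G.H1 →+ ℤ) G.H1 ℤ)

instance : AddMonoidHomClass G.N G.H1 ℤ :=
  inferInstanceAs (AddMonoidHomClass (G.H1 →+ ℤ) G.H1 ℤ)

/-- `N_A = A ⊗ N = H¹(G, A) = Hom(H₁(G, ℤ), A)`. -/
def Coh (A : Type*) [CommRing A] : Type _ := G.H1 →+ A

section

variable (A : Type*) [CommRing A]

instance : AddCommGroup (G.Coh A) := inferInstanceAs (AddCommGroup (G.H1 →+ A))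

instance : Module A (G.Coh A) := inferInstanceAs (Module A (G.H1 →+ A))

instance : FunLike (G.Coh A) G.H1 A := inferInstanceAs (FunLike (G.H1 →+ A) G.H1 A)

instance : AddMonoidHomClass (G.Coh A) G.H1 A :=
  inferInstanceAs (AddMonoidHomClass (G.H1 →+ A) G.H1 A)

end

section

variable {G} {A : Type*} [CommRing A]

@[ext] theorem N.ext {n n' : G.N} (h : ∀ γ, n γ = n' γ) : n = n' := DFunLike.ext _ _ h

@[simp] theorem N.add_apply (n n' : G.N) (γ : G.H1) : (n + n') γ = n γ + n' γ := rfl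

@[simp] theorem N.zero_apply (γ : G.H1) : (0 : G.N) γ = 0 := rfl

@[ext] theorem Coh.ext {u u' : G.Coh A} (h : ∀ γ, u γ = u' γ) : u = u' := DFunLike.ext _ _ h

@[simp] theorem Coh.add_apply (u u' : G.Coh A) (γ : G.H1) : (u + u') γ = u γ + u' γ := rfl

@[simp] theorem Coh.zero_apply (γ : G.H1) : (0 : G.Coh A) γ = 0 := rfl

@[simp] theorem Coh.smul_apply (c : A) (u : G.Coh A) (γ : G.H1) : (c • u) γ = c * u γ := rfl

@[simp] theorem Coh.sum_apply {ι : Type*} (s : Finset ι) (u : ι → G.Coh A) (γ : G.H1) :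
    (∑ i ∈ s, u i) γ = ∑ i ∈ s, u i γ :=
  AddMonoidHom.finsetSum_apply (M := G.H1) (N := A) u s γ

end

/-- The natural map `N → N_A`. -/
def toCoh (A : Type*) [CommRing A] : G.N →+ G.Coh A where
  toFun n := (Int.castAddHom A).comp n
  map_zero' := by ext γ; exact Int.cast_zero
  map_add' n n' := by ext γ; exact Int.cast_add _ _

@[simp] theorem toCoh_apply {A : Type*} [CommRing A] (n : G.N) (γ : G.H1) :
    G.toCoh A n γ = (n γ : A) := rfl

/-- The element of `N` sending a cycle to its coefficient at `e`.  It is `x_e⁻¹ π(e)`, see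
`smul_dir`. -/
def dir (e : E) : G.N := (Finsupp.applyAddHom e).comp G.H1.subtype.toAddMonoidHom

@[simp] theorem dir_apply (e : E) (γ : G.H1) : G.dir e γ = (γ : E →₀ ℤ) e := rfl

theorem exists_path (v w : V) :
    ∃ c : E →₀ ℤ, G.bdry c = Finsupp.single w (1 : ℤ) - Finsupp.single v 1 := by
  induction G.connected v w with
  | rel a b h =>
    obtain ⟨e, rfl, rfl⟩ := h
    exact ⟨Finsupp.single e 1, by simp [bdry]⟩
  | refl a => exact ⟨0, by simp⟩
  | symm a b _ ih => obtain ⟨c, hc⟩ := ih; exact ⟨-c, by simp [hc]⟩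
  | trans a b d _ _ ih ih' =>
    obtain ⟨c, hc⟩ := ih
    obtain ⟨c', hc'⟩ := ih'
    exact ⟨c + c', by rw [map_add, hc, hc']; abel⟩

/-- A path from `v` to `w`, as a 1-chain with boundary `w - v`.  Two such chains differ by an
element of `H₁(G, ℤ)`, hence their images under `π` differ by an element of `Λ`. -/
def path (v w : V) : E →₀ ℤ := (G.exists_path v w).choose

variable [Fintype E]

/-- The length pairing `C₁ × C₁ → A` with `[e, e] = x e` and `[e, e'] = 0` for `e ≠ e'`. -/
def pairing {A : Type*} [CommRing A] (x : E → A) :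
    (E →₀ ℤ) →ₗ[ℤ] (E →₀ ℤ) →ₗ[ℤ] A :=
  LinearMap.mk₂ ℤ (fun c d => ∑ e, (c e * d e) • x e)
    (fun c c' d => by simp [add_mul, add_smul, Finset.sum_add_distrib])
    (fun k c d => by simp [mul_smul, Finset.smul_sum, mul_assoc])
    (fun c d d' => by simp [mul_add, add_mul, Finset.sum_add_distrib])
    (fun k c d => by
      simp only [Finsupp.smul_apply, Finset.smul_sum, smul_smul, smul_eq_mul]
      exact Finset.sum_congr rfl fun e _ => by rw [mul_left_comm])

/-- `π : C₁(G, ℤ) → N_A`, `c ↦ [c, ·]`. -/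
def proj {A : Type*} [CommRing A] (x : E → A) : (E →₀ ℤ) →+ G.Coh A where
  toFun c := ((pairing x c).comp G.H1.subtype).toAddMonoidHom
  map_zero' := by rw [map_zero]; rfl
  map_add' c d := by rw [map_add]; rfl

@[simp] theorem proj_apply {A : Type*} [CommRing A] (x : E → A) (c : E →₀ ℤ) (γ : G.H1) :
    G.proj x c γ = pairing x c γ := rfl

/-- The lattice `Λ = π(H₁(G, ℤ)) ⊆ N_A`. -/
def lattice {A : Type*} [CommRing A] (x : E → A) : AddSubgroup (G.Coh A) :=
  G.H1.toAddSubgroup.map (G.proj x)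

theorem smul_dir {A : Type*} [CommRing A] (x : E → A) (e : E) :
    x e • G.toCoh A (G.dir e) = G.proj x (Finsupp.single e 1) := by
  classical
  ext γ
  simp only [Coh.smul_apply, toCoh_apply, dir_apply, proj_apply, pairing, LinearMap.mk₂_apply]
  rw [Finset.sum_eq_single e]
  · simp [mul_comm]
  · intro b _ hb
    simp [hb.symm]
  · simp

end MGraph

/-! ### Chain complexes from face maps -/

/-- The alternating sum of face maps on free abelian groups. -/
def altBdry {S T : Type*} {q : ℕ} (face : Fin (q + 2) → S → T) :
    FreeAbelianGroup S →+ FreeAbelianGroup T :=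
  ∑ i : Fin (q + 2), (-1 : ℤ) ^ (i : ℕ) • FreeAbelianGroup.map (face i)

/-! ### The universal Jacobian: ordered simplices modulo translation -/

section Ordered

variable {M : Type*} [AddCommGroup M] (L : AddSubgroup M)

/-- `(u₀ + l, …, u_q + l) ∼ (u₀, …, u_q)` for `l ∈ L`. -/
def ordSetoid (q : ℕ) : Setoid (Fin (q + 1) → M) where
  r u u' := ∃ l ∈ L, ∀ i, u' i = u i + l
  iseqv :=
    { refl := fun u => ⟨0, L.zero_mem, by simp⟩
      symm := by
        rintro u u' ⟨l, hl, h⟩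
        exact ⟨-l, L.neg_mem hl, fun i => by rw [h i]; abel⟩
      trans := by
        rintro u u' u'' ⟨l, hl, h⟩ ⟨l', hl', h'⟩
        exact ⟨l + l', L.add_mem hl hl', fun i => by rw [h' i, h i]; abel⟩ }

/-- Ordered `q`-simplices of `M / L`. -/
abbrev OrdSimplex (q : ℕ) : Type _ := Quotient (ordSetoid L q)

/-- The class of the ordered simplex `(u₀, …, u_q)`. -/
def ordMk {q : ℕ} (u : Fin (q + 1) → M) : OrdSimplex L q := Quotient.mk (ordSetoid L q) u

/-- Omitting the `i`-th vertex. -/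
def ordFace {q : ℕ} (i : Fin (q + 2)) : OrdSimplex L (q + 1) → OrdSimplex L q :=
  Quotient.map' (fun u j => u (i.succAbove j)) (by
    rintro u u' ⟨l, hl, h⟩
    exact ⟨l, hl, fun j => h _⟩)

/-- The inversion `(u₀, …, u_q) ↦ (-u₀, …, -u_q)`. -/
def ordNeg {q : ℕ} : OrdSimplex L q → OrdSimplex L q :=
  Quotient.map' (fun u j => -u j) (by
    rintro u u' ⟨l, hl, h⟩
    exact ⟨-l, L.neg_mem hl, fun j => by simp only [h j]; abel⟩)

end Ordered

namespace MGraph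

variable {V E : Type*} [Fintype E] (G : MGraph V E)

/-! ### The universal Ceresa period -/

section Universal

/-! The definitions of this section are used for the polynomial ring `A = ℤ[x_e | e ∈ E(G)]` with
its variables `x_e`, but they make sense for all rings `A` and elements `x_e` of `A`. -/

variable {A : Type*} [CommRing A] (x : E → A)

/-- The chains `C_{1,q}(Jac(G)) = N ⊗ C_q(Jac(G))`, where `C_q(Jac(G))` is the free abelian group
on the ordered `q`-simplices of `N_A` modulo translation by `Λ`. -/
abbrev UChain (q : ℕ) : Type _ := G.N ⊗[ℤ] FreeAbelianGroup (OrdSimplex (G.lattice x) q)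

/-- The boundary `C_{1,q+1}(Jac(G)) → C_{1,q}(Jac(G))`. -/
def uBdry (q : ℕ) : G.UChain x (q + 1) →+ G.UChain x q :=
  (LinearMap.lTensor G.N (altBdry (ordFace (G.lattice x))).toIntLinearMap).toAddMonoidHom

/-- The pushforward `[-1]_*` on `C_{1,q}(Jac(G))`. -/
def uNeg (q : ℕ) : G.UChain x q →+ G.UChain x q :=
  (TensorProduct.map (-LinearMap.id)
    (FreeAbelianGroup.map (ordNeg (G.lattice x))).toIntLinearMap).toAddMonoidHom

/-- `Φ_v(e) = x_e⁻¹ π(e) ⊗ (π(δ_e), π(δ_e + e))`, with `δ_e` a path from `v` to `e⁻`. -/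
def uPhi (v : V) (e : E) : G.UChain x 1 :=
  G.dir e ⊗ₜ[ℤ] FreeAbelianGroup.of
    (ordMk (G.lattice x)
      ![G.proj x (G.path v (G.tail e)),
        G.proj x (G.path v (G.tail e) + Finsupp.single e 1)])

/-- The universal Ceresa cycle `Cer_v(G)`. -/
def uCer (v : V) : G.UChain x 1 := ∑ e, G.uPhi x v e - G.uNeg x 1 (∑ e, G.uPhi x v e)

/-- `n ↦ n ∧ (u₁ - u₀) ∧ (u₂ - u₀)` on `N`, for an ordered 2-simplex of `N_A`. -/
def uThetaFun (u : Fin 3 → G.Coh A) : G.N →ₗ[ℤ] ⋀[A]^3 (G.Coh A) :=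
  AddMonoidHom.toIntLinearMap
    { toFun := fun n => wedge A (G.toCoh A n) (u 1 - u 0) (u 2 - u 0)
      map_zero' := by
        rw [map_zero]
        exact AlternatingMap.map_coord_zero _ (0 : Fin 3) rfl
      map_add' := fun n n' => by
        rw [map_add]
        exact MultilinearMap.cons_add _ _ _ _ }

/-- `Θ : C_{1,2}(Jac(G)) → N_A^{∧3}`, `n ⊗ (u₀, u₁, u₂) ↦ n ∧ (u₁ - u₀) ∧ (u₂ - u₀)`. -/
def uTheta : G.UChain x 2 →+ ⋀[A]^3 (G.Coh A) :=
  (TensorProduct.lift (LinearMap.flip (FreeAbelianGroup.lift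
    (fun s : OrdSimplex (G.lattice x) 2 => Quotient.liftOn s G.uThetaFun (by
      rintro u u' ⟨l, -, h⟩
      have h1 : u' 1 - u' 0 = u 1 - u 0 := by rw [h 1, h 0]; abel
      have h2 : u' 2 - u' 0 = u 2 - u 0 := by rw [h 2, h 0]; abel
      ext1 n
      simp [uThetaFun, h1, h2]))).toIntLinearMap)).toAddMonoidHom

/-- `𝒫 = Θ(H_{1,2}(Jac(G)))`, the values of `Θ` on the cycles of `C_{1,2}(Jac(G))`. -/
def uPeriods : AddSubgroup (⋀[A]^3 (G.Coh A)) :=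
  (G.uBdry x 1).ker.map (G.uTheta x)

/-- The universal Ceresa period `α(G) ∈ N_A^{∧3} / 𝒫`: the class of `Θ(Σ)` for any `Σ` with
`∂Σ = Cer_v(G)`. -/
def uAlpha (v : V) : ⋀[A]^3 (G.Coh A) ⧸ G.uPeriods x :=
  QuotientAddGroup.mk
    (G.uTheta x (Classical.epsilon fun S : G.UChain x 2 => G.uBdry x 1 S = G.uCer x v))

end Universal

/-! ### Smooth simplices in the tropical Jacobian -/

variable (l : E → ℝ)

/-- The tropical Jacobian `Jac(C) = N_ℝ / Λ_C` of the tropical curve with model `(G, l)`. -/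
abbrev Jac : Type _ := G.Coh ℝ ⧸ G.lattice l

/-- `f` is a smooth map into `N_ℝ` near the point `t ∈ ℝ^{q+1}` and lifts `s` on the part of the
standard simplex near `t`.  Smoothness into the finite-dimensional space
`N_ℝ = Hom(H₁(G, ℤ), ℝ)` is smoothness of all the coordinates `u ↦ u(γ)`. -/
def IsLocalLift {q : ℕ} (s : stdSimplex ℝ (Fin (q + 1)) → G.Jac l) (t : Fin (q + 1) → ℝ)
    (f : (Fin (q + 1) → ℝ) → G.Coh ℝ) : Prop :=
  ∃ U : Set (Fin (q + 1) → ℝ), IsOpen U ∧ t ∈ U ∧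
    (∀ γ : G.H1, ContDiffOn ℝ ∞ (fun y => f y γ) U) ∧
    ∀ y : stdSimplex ℝ (Fin (q + 1)), (y : Fin (q + 1) → ℝ) ∈ U →
      QuotientAddGroup.mk' (G.lattice l) (f y) = s y

/-- Smooth singular `q`-simplices `Δ^q → Jac(C)`.  The smooth structure of `Jac(C)` is the
quotient one, so that a map is smooth if and only if it locally lifts to a smooth map
into `N_ℝ`. -/
def SmoothSimplex (q : ℕ) : Type _ :=
  {s : stdSimplex ℝ (Fin (q + 1)) → G.Jac l // ∀ t : stdSimplex ℝ (Fin (q + 1)),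
    ∃ f, G.IsLocalLift l s t f}

/-- The `i`-th face of a smooth simplex: restriction to the face opposite to the `i`-th vertex. -/
def smFace {q : ℕ} (i : Fin (q + 2)) (s : G.SmoothSimplex l (q + 1)) : G.SmoothSimplex l q :=
  ⟨fun t => s.1 (stdSimplex.map i.succAbove t), fun t => by
    obtain ⟨f, U, hU, ht, hf, hs⟩ := s.2 (stdSimplex.map i.succAbove t)
    have hc : ContDiff ℝ ∞ (FunOnFinite.linearMap ℝ ℝ i.succAbove) :=
      (LinearMap.toContinuousLinearMap (FunOnFinite.linearMap ℝ ℝ i.succAbove)).contDiff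
    exact ⟨fun y => f (FunOnFinite.linearMap ℝ ℝ i.succAbove y),
      FunOnFinite.linearMap ℝ ℝ i.succAbove ⁻¹' U, hU.preimage hc.continuous, ht,
      fun γ => (hf γ).comp hc.contDiffOn (fun _ h => h),
      fun y hy => hs (stdSimplex.map i.succAbove y) hy⟩⟩

/-- The affine simplex `(u₀, …, u_q)` of `Jac(C)`. -/
def affine {q : ℕ} (u : Fin (q + 1) → G.Coh ℝ) : G.SmoothSimplex l q :=
  ⟨fun t => QuotientAddGroup.mk' (G.lattice l) (∑ i, t i • u i), fun t =>
    ⟨fun y => ∑ i, y i • u i, Set.univ, isOpen_univ, trivial, fun γ => by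
      simp only [Coh.sum_apply, Coh.smul_apply]
      fun_prop, fun y _ => rfl⟩⟩

/-- The smooth tropical chains `S_{1,q}(Jac(C)) = N ⊗ S_q(Jac(C))`. -/
abbrev SChain (q : ℕ) : Type _ := G.N ⊗[ℤ] FreeAbelianGroup (G.SmoothSimplex l q)

/-- The boundary `S_{1,q+1}(Jac(C)) → S_{1,q}(Jac(C))`. -/
def sBdry (q : ℕ) : G.SChain l (q + 1) →+ G.SChain l q :=
  (LinearMap.lTensor G.N (altBdry (G.smFace l)).toIntLinearMap).toAddMonoidHom

/-! ### The tropical Ceresa cycle -/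

/-- The points of the tropical curve with model `(G, l)`: vertices, and interior points of an
edge `e` at distance `t` from `e⁻`. -/
inductive Point {V E : Type*} (l : E → ℝ) : Type _
  | vertex (v : V) : Point l
  | inner (e : E) (t : ℝ) (h0 : 0 < t) (h1 : t < l e) : Point l

/-- The vertex from which the point `p` is reached along at most one partial edge. -/
def baseVertex : Point (V := V) l → V
  | .vertex v => v
  | .inner e _ _ _ => G.tail e

/-- The image under `π` of the partial edge from `baseVertex p` to `p`. -/
def offset : Point (V := V) l → G.Coh ℝ
  | .vertex _ => 0
  | .inner e t _ _ => t • G.toCoh ℝ (G.dir e)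

open Classical in
/-- The coarsest refinement of `(G, l)` having `p` as a vertex: the edge `e ≅ [0, l e]` is replaced
by the listed subintervals. -/
def segments (p : Point (V := V) l) (e : E) : List (ℝ × ℝ) :=
  match p with
  | .vertex _ => [(0, l e)]
  | .inner e' t _ _ => if e = e' then [(0, t), (t, l e)] else [(0, l e)]

/-- A lift to `N_ℝ` of the image under the Abel--Jacobi map based at `p` of the point
of the edge `e` at distance `a` from `e⁻`, namely `π(δ)` for a path `δ` from `p` to that point. -/
def abelJacobi (p : Point (V := V) l) (e : E) (a : ℝ) : G.Coh ℝ :=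
  G.proj l (G.path (G.baseVertex l p) (G.tail e)) - G.offset l p + a • G.toCoh ℝ (G.dir e)

/-- The tropical Ceresa cycle `Cer_p(C)`: the sum over the edges `e` of a model having `p` as a
vertex of `l(e)⁻¹ π(e) ⊗ ((π(δ_e), π(δ_e + e)) + (-π(δ_e), -π(δ_e + e)))`, where `δ_e` is a path
from `p` to `e⁻`. -/
def sCer (p : Point (V := V) l) : G.SChain l 1 :=
  ∑ e, ((segments l p e).map fun s => G.dir e ⊗ₜ[ℤ]
    (FreeAbelianGroup.of (G.affine l ![G.abelJacobi l p e s.1, G.abelJacobi l p e s.2]) +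
      FreeAbelianGroup.of
        (G.affine l ![-G.abelJacobi l p e s.1, -G.abelJacobi l p e s.2]))).sum

/-! ### Integration and the Ceresa period of a tropical curve -/

/-- A smooth lift of `s` to `N_ℝ` near `t`.  It is unique on the simplex up to a translation by
`Λ_C`, hence its derivatives along the simplex do not depend on the choice. -/
def localLift {q : ℕ} (s : G.SmoothSimplex l q) (t : Fin (q + 1) → ℝ) :
    (Fin (q + 1) → ℝ) → G.Coh ℝ :=
  Classical.epsilon (G.IsLocalLift l s.1 t)

/-- The partial derivative `∂ z_γ / ∂ t_k` at `t` of a smooth simplex, where `z_γ(u) = u(γ)` and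
`t₁, …, t_q` are used as coordinates on `Δ^q` (so that `t₀ = 1 - t₁ - ⋯ - t_q`). -/
def partialD {q : ℕ} (s : G.SmoothSimplex l q) (γ : G.H1) (k : Fin (q + 1))
    (t : Fin (q + 1) → ℝ) : ℝ :=
  fderiv ℝ (fun y => G.localLift l s t y γ) t (Pi.single k 1 - Pi.single 0 1)

/-- `∫_s dz_γ ∧ dz_γ'` for a smooth 2-simplex `s`. -/
def integral2 (s : G.SmoothSimplex l 2) (γ γ' : G.H1) : ℝ :=
  ∫ y in {y : ℝ × ℝ | 0 ≤ y.1 ∧ 0 ≤ y.2 ∧ y.1 + y.2 ≤ 1},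
    (G.partialD l s γ 1 ![1 - y.1 - y.2, y.1, y.2] *
        G.partialD l s γ' 2 ![1 - y.1 - y.2, y.1, y.2] -
      G.partialD l s γ 2 ![1 - y.1 - y.2, y.1, y.2] *
        G.partialD l s γ' 1 ![1 - y.1 - y.2, y.1, y.2])

variable {g : ℕ} (b : Module.Basis (Fin g) ℤ G.H1)

/-- The basis element `ε_i` of `N`, viewed in `N_ℝ`, where `ε` is dual to the basis `b` of
`H₁(G, ℤ)`. -/
def eps (i : Fin g) : G.Coh ℝ := G.toCoh ℝ ((b.coord i).toAddMonoidHom : G.H1 →+ ℤ)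

/-- `n ↦ 2 ∑_{i<j<k} (∫_s n_i dz_j ∧ dz_k - n_j dz_i ∧ dz_k + n_k dz_i ∧ dz_j) ε_i ∧ ε_j ∧ ε_k`.
The coordinates on `N_ℝ` with respect to `ε` are `z_i(u) = u(b i)`. -/
def sThetaFun (s : G.SmoothSimplex l 2) : G.N →ₗ[ℤ] ⋀[ℝ]^3 (G.Coh ℝ) :=
  AddMonoidHom.toIntLinearMap
    { toFun := fun n =>
        ∑ I : Fin g × Fin g × Fin g with I.1 < I.2.1 ∧ I.2.1 < I.2.2,
          (2 * ((n (b I.1) : ℝ) * G.integral2 l s (b I.2.1) (b I.2.2)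
            - (n (b I.2.1) : ℝ) * G.integral2 l s (b I.1) (b I.2.2)
            + (n (b I.2.2) : ℝ) * G.integral2 l s (b I.1) (b I.2.1))) •
          wedge ℝ (G.eps b I.1) (G.eps b I.2.1) (G.eps b I.2.2)
      map_zero' := by simp
      map_add' := fun n n' => by
        rw [← Finset.sum_add_distrib]
        refine Finset.sum_congr rfl fun I _ => ?_
        rw [← add_smul]
        congr 1
        simp only [N.add_apply, Int.cast_add]
        ring }

/-- The integration map `Θ_C : S_{1,2}(Jac(C)) → N_ℝ^{∧3}`. -/
def sTheta : G.SChain l 2 →+ ⋀[ℝ]^3 (G.Coh ℝ) :=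
  (TensorProduct.lift
    (LinearMap.flip (FreeAbelianGroup.lift (G.sThetaFun l b)).toIntLinearMap)).toAddMonoidHom

/-- `𝒫_C = Θ_C(H_{1,2}(Jac(C)))`, the values of `Θ_C` on the cycles of `S_{1,2}(Jac(C))`. -/
def sPeriods : AddSubgroup (⋀[ℝ]^3 (G.Coh ℝ)) :=
  (G.sBdry l 1).ker.map (G.sTheta l b)

/-- The Ceresa period `α(C) ∈ N_ℝ^{∧3} / 𝒫_C`: the class of `Θ_C(Σ)` for any `Σ` with
`∂Σ = Cer_p(C)`. -/
def sAlpha (p : Point (V := V) l) : ⋀[ℝ]^3 (G.Coh ℝ) ⧸ G.sPeriods l b :=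
  QuotientAddGroup.mk
    (G.sTheta l b (Classical.epsilon fun S : G.SChain l 2 => G.sBdry l 1 S = G.sCer l p))

/-! ### Evaluation -/

/-- The ring map `ev : R = ℤ[x_e | e ∈ E(G)] → ℝ`, `x_e ↦ l(e)`. -/
def evRing {E : Type*} (l : E → ℝ) : MvPolynomial E ℤ →+* ℝ :=
  MvPolynomial.eval₂Hom (Int.castRingHom ℝ) l

/-- The variables `x_e` of `R`. -/
abbrev vars (E : Type*) : E → MvPolynomial E ℤ := MvPolynomial.X

/-- The induced map `N_R → N_ℝ`. -/
def evCoh : G.Coh (MvPolynomial E ℤ) →ₛₗ[evRing l] G.Coh ℝ where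
  toFun u := (evRing l).toAddMonoidHom.comp u
  map_add' u u' := by ext γ; exact map_add (evRing l) _ _
  map_smul' c u := by ext γ; exact map_mul (evRing l) _ _

/-- The induced map `N_R^{∧3} → N_ℝ^{∧3}`. -/
def evExt : ⋀[MvPolynomial E ℤ]^3 (G.Coh (MvPolynomial E ℤ)) →+ ⋀[ℝ]^3 (G.Coh ℝ) :=
  (extMap (evRing l) 3 (G.evCoh l)).toAddMonoidHom

end MGraph

end Ceresa

end

open scoped TensorProduct ContDiff

noncomputable section

namespace Ceresa

/-! ### Chains with coefficients in an abelian group -/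

section Chains

variable {N X S T S' T' : Type*} [AddCommGroup N] [AddCommGroup X]

/-! Universal ordered chains, real ordered chains modulo Λ_C and smooth chains are compared, the
real ordered chains being the middle term: evaluation maps into them, affine simplices embed them
into smooth chains, and straightening (keep only the vertices of a lift) maps smooth chains back.

Existence of fillings. Modulo boundaries the edge (u, v) equals p(v) - p(u), where p(u) is the class
of (0, u). Translating u by a ∈ Λ changes p by p(a), and p(-a) = -p(a); hence p(u) + p(-u) is
Λ-invariant (`symPotential_add`). So the Ceresa cycle becomes ∑ n_e ⊗ (f(e⁺) - f(e⁻)) for a function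
f on the vertices, and this vanishes because H₁ is the kernel of the boundary (`sum_dir_tmul_sub`).
Right exactness of N ⊗ - then yields a filling.

Base points. Edges are parallel to their coefficients n_e, so the prisms that translate the graph
have no net area in Θ, and neither do the triangles that subdivide an edge. All Ceresa cycles
therefore differ by boundaries of chains in ker Θ (`ordCer_sub_uCer_mem`).

Universal against real periods. Evaluation commutes with Θ and ∂, so one inclusion is formal. For
the other, a real cycle is first moved so that its vertices lie in Λ_C, by a possibly discontinuous
map ρ commuting with translations by Λ_C. The displacement ρ(u) - u is periodic, so the change of Θ
is a coboundary (`wedge_move_vertices`) and vanishes on cycles. The moved cycle lifts to the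
universal side because π is injective on H₁, the length pairing being positive definite.

Smooth against ordered periods. A smooth simplex has a global smooth lift to N_ℝ, unique up to Λ_C
on the simplex. Stokes' theorem for ∫ dz ∧ dz' shows that a triangle and its straightening differ by
a sum over the edges of ∫ z dz' minus its value on the chord (`IsSmoothLift.integral2_eq`). This
edge term is translation invariant, hence a cochain on the Jacobian, and is zero on affine edges. So
Θ_C is Θ of the straightening on cycles and on fillings of affine chains, which identifies both the
periods and the Ceresa classes. -/

/-- Two homomorphisms on `N ⊗ ℤ[S]` agree if they agree on the elements `n ⊗ s`. -/
theorem tensorFree_hom_ext {f f' : N ⊗[ℤ] FreeAbelianGroup S →+ X}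
    (h : ∀ n s, f (n ⊗ₜ FreeAbelianGroup.of s) = f' (n ⊗ₜ FreeAbelianGroup.of s)) : f = f' := by
  ext c
  induction c with
  | zero => simp
  | add a b ha hb => simp [ha, hb]
  | tmul n s =>
    induction s using FreeAbelianGroup.induction_on with
    | zero => simp
    | of s => exact h n s
    | neg s hs => simp only [TensorProduct.tmul_neg, map_neg, hs]
    | add a b ha hb => simp only [TensorProduct.tmul_add, map_add, ha, hb]

/-- The homomorphism `N ⊗ ℤ[S] → N ⊗ ℤ[T]` induced by a map `S → T`. -/
def pushChain (N : Type*) [AddCommGroup N] (f : S → T) :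
    N ⊗[ℤ] FreeAbelianGroup S →+ N ⊗[ℤ] FreeAbelianGroup T :=
  (LinearMap.lTensor N (FreeAbelianGroup.map f).toIntLinearMap).toAddMonoidHom

/-- The alternating sum of face maps with coefficients in `N`. -/
def bdryChain (N : Type*) [AddCommGroup N] {q : ℕ} (face : Fin (q + 2) → S → T) :
    N ⊗[ℤ] FreeAbelianGroup S →+ N ⊗[ℤ] FreeAbelianGroup T :=
  (LinearMap.lTensor N (altBdry face).toIntLinearMap).toAddMonoidHom

/-- The homomorphism `N ⊗ ℤ[S] → X` given by a family of homomorphisms `N → X`. -/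
def evalChain (f : S → N →ₗ[ℤ] X) : N ⊗[ℤ] FreeAbelianGroup S →+ X :=
  (TensorProduct.lift (LinearMap.flip (FreeAbelianGroup.lift f).toIntLinearMap)).toAddMonoidHom

@[simp] theorem pushChain_tmul (f : S → T) (n : N) (s : FreeAbelianGroup S) :
    pushChain N f (n ⊗ₜ s) = n ⊗ₜ FreeAbelianGroup.map f s := rfl

@[simp] theorem bdryChain_tmul {q : ℕ} (face : Fin (q + 2) → S → T) (n : N)
    (s : FreeAbelianGroup S) : bdryChain N face (n ⊗ₜ s) = n ⊗ₜ altBdry face s := rfl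

@[simp] theorem evalChain_tmul (f : S → N →ₗ[ℤ] X) (n : N) (s : FreeAbelianGroup S) :
    evalChain f (n ⊗ₜ s) = FreeAbelianGroup.lift f s n := rfl

theorem evalChain_tmul_of (f : S → N →ₗ[ℤ] X) (n : N) (s : S) :
    evalChain f (n ⊗ₜ FreeAbelianGroup.of s) = f s n := by simp

@[simp] theorem altBdry_of {q : ℕ} (face : Fin (q + 2) → S → T) (s : S) :
    altBdry face (FreeAbelianGroup.of s) =
      ∑ i : Fin (q + 2), (-1 : ℤ) ^ (i : ℕ) • FreeAbelianGroup.of (face i s) := by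
  simp [altBdry, AddMonoidHom.finsetSum_apply]

theorem pushChain_pushChain {U : Type*} (f : S → T) (g : T → U)
    (c : N ⊗[ℤ] FreeAbelianGroup S) :
    pushChain N g (pushChain N f c) = pushChain N (fun s => g (f s)) c := by
  have : (pushChain N g).comp (pushChain N f) = pushChain N (fun s => g (f s)) :=
    tensorFree_hom_ext fun n s => by simp
  exact DFunLike.congr_fun this c

theorem pushChain_eq_self {f : S → S} (h : ∀ s, f s = s) (c : N ⊗[ℤ] FreeAbelianGroup S) :
    pushChain N f c = c := by
  have : pushChain N f = AddMonoidHom.id _ := tensorFree_hom_ext fun n s => by simp [h]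
  exact DFunLike.congr_fun this c

/-- A map of simplices that commutes with the faces commutes with the boundary. -/
theorem bdryChain_pushChain {q : ℕ} {face : Fin (q + 2) → S → T} {face' : Fin (q + 2) → S' → T'}
    {f : S → S'} {f' : T → T'} (h : ∀ i s, face' i (f s) = f' (face i s))
    (c : N ⊗[ℤ] FreeAbelianGroup S) :
    bdryChain N face' (pushChain N f c) = pushChain N f' (bdryChain N face c) := by
  have : (bdryChain N face').comp (pushChain N f) = (pushChain N f').comp (bdryChain N face) :=
    tensorFree_hom_ext fun n s => by simp [h, TensorProduct.tmul_sum]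
  exact DFunLike.congr_fun this c

theorem evalChain_pushChain (f : S → T) (θ : T → N →ₗ[ℤ] X) (c : N ⊗[ℤ] FreeAbelianGroup S) :
    evalChain θ (pushChain N f c) = evalChain (fun s => θ (f s)) c := by
  have : (evalChain θ).comp (pushChain N f) = evalChain (fun s => θ (f s)) :=
    tensorFree_hom_ext fun n s => by simp
  exact DFunLike.congr_fun this c

/-- Cochains that differ by the coboundary of `h` differ by the value of `h` on the boundary. -/
theorem evalChain_add_coboundary {q : ℕ} {face : Fin (q + 2) → S → T} {θ θ' : S → N →ₗ[ℤ] X}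
    (h : T → N →ₗ[ℤ] X)
    (H : ∀ s n, θ' s n = θ s n + ∑ i : Fin (q + 2), (-1 : ℤ) ^ (i : ℕ) • h (face i s) n)
    (c : N ⊗[ℤ] FreeAbelianGroup S) :
    evalChain θ' c = evalChain θ c + evalChain h (bdryChain N face c) := by
  have : evalChain θ' = evalChain θ + (evalChain h).comp (bdryChain N face) := by
    refine tensorFree_hom_ext fun n s => ?_
    simp [H, TensorProduct.tmul_sum]
  exact DFunLike.congr_fun this c

theorem map_evalChain {Y : Type*} [AddCommGroup Y] (φ : X →+ Y) (θ : S → N →ₗ[ℤ] X)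
    (θ' : S → N →ₗ[ℤ] Y) (h : ∀ s n, φ (θ s n) = θ' s n) (c : N ⊗[ℤ] FreeAbelianGroup S) :
    φ (evalChain θ c) = evalChain θ' c := by
  have : φ.comp (evalChain θ) = evalChain θ' := tensorFree_hom_ext fun n s => by simp [h]
  exact DFunLike.congr_fun this c

/-- A chain is a boundary if it vanishes in `N ⊗ (ℤ[T] / ∂ ℤ[S])`. -/
theorem exists_bdryChain_eq {q : ℕ} (face : Fin (q + 2) → S → T) (c : N ⊗[ℤ] FreeAbelianGroup T)
    (hc : LinearMap.lTensor N
      (QuotientAddGroup.mk' (altBdry face).range).toIntLinearMap c = 0) :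
    ∃ d, bdryChain N face d = c := by
  have hex : Function.Exact (altBdry face).toIntLinearMap
      (QuotientAddGroup.mk' (altBdry face).range).toIntLinearMap := by
    intro y
    simp
  -- Right exactness of N ⊗ - for ℤ[S] → ℤ[T] → coker; no flatness of N is needed.
  have := (lTensor_exact N hex (QuotientAddGroup.mk'_surjective _) c).mp hc
  exact this

end Chains

/-! ### Ordered simplices modulo translation -/

theorem face_zero_edge {M : Type*} (u v w : M) :
    (fun j => ![u, v, w] ((0 : Fin 3).succAbove j)) = ![v, w] := by
  ext j; fin_cases j <;> rfl

theorem face_one_edge {M : Type*} (u v w : M) :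
    (fun j => ![u, v, w] ((1 : Fin 3).succAbove j)) = ![u, w] := by
  ext j; fin_cases j <;> rfl

theorem face_two_edge {M : Type*} (u v w : M) :
    (fun j => ![u, v, w] ((2 : Fin 3).succAbove j)) = ![u, v] := by
  ext j; fin_cases j <;> rfl

section Ordered

variable {M M' : Type*} [AddCommGroup M] [AddCommGroup M'] {L : AddSubgroup M}
  {L' : AddSubgroup M'}

theorem ordMk_eq_ordMk {q : ℕ} {u u' : Fin (q + 1) → M} {a : M} (ha : a ∈ L)
    (h : ∀ i, u' i = u i + a) : ordMk L u = ordMk L u' :=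
  Quotient.sound ⟨a, ha, h⟩

@[simp] theorem ordFace_ordMk {q : ℕ} (i : Fin (q + 2)) (u : Fin (q + 2) → M) :
    ordFace L i (ordMk L u) = ordMk L (fun j => u (i.succAbove j)) := rfl

@[simp] theorem ordNeg_ordMk {q : ℕ} (u : Fin (q + 1) → M) :
    ordNeg L (ordMk L u) = ordMk L (fun j => -u j) := rfl

/-- The map of ordered simplices induced by a map that is equivariant modulo the lattices. -/
def ordMap (f : M → M') (hf : ∀ a ∈ L, ∃ a' ∈ L', ∀ u, f (u + a) = f u + a') {q : ℕ} :
    OrdSimplex L q → OrdSimplex L' q :=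
  Quotient.map' (fun u j => f (u j)) (by
    rintro u u' ⟨a, ha, h⟩
    obtain ⟨a', ha', h'⟩ := hf a ha
    exact ⟨a', ha', fun i => by simp only [h i, h']⟩)

@[simp] theorem ordMap_ordMk (f : M → M') (hf : ∀ a ∈ L, ∃ a' ∈ L', ∀ u, f (u + a) = f u + a')
    {q : ℕ} (u : Fin (q + 1) → M) : ordMap f hf (ordMk L u) = ordMk L' (fun j => f (u j)) := rfl

theorem ordFace_ordMap (f : M → M') (hf : ∀ a ∈ L, ∃ a' ∈ L', ∀ u, f (u + a) = f u + a') {q : ℕ}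
    (i : Fin (q + 2)) (s : OrdSimplex L (q + 1)) :
    ordFace L' i (ordMap f hf s) = ordMap f hf (ordFace L i s) := by
  induction s using Quotient.inductionOn with
  | h u => rfl

/-- `∂(u, v, w) = (v, w) - (u, w) + (u, v)`. -/
theorem altBdry_triangle (L : AddSubgroup M) (u v w : M) :
    altBdry (ordFace L) (FreeAbelianGroup.of (ordMk L ![u, v, w])) =
      FreeAbelianGroup.of (ordMk L ![v, w]) - FreeAbelianGroup.of (ordMk L ![u, w]) +
        FreeAbelianGroup.of (ordMk L ![u, v]) := by
  rw [altBdry_of, Fin.sum_univ_three, ordFace_ordMk, ordFace_ordMk, ordFace_ordMk,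
    face_zero_edge, face_one_edge, face_two_edge]
  simp [sub_eq_add_neg]

/-- `ℤ`-combinations of ordered edges modulo boundaries. -/
abbrev EdgeClass (L : AddSubgroup M) : Type _ :=
  FreeAbelianGroup (OrdSimplex L 1) ⧸ (altBdry (q := 1) (ordFace L)).range

/-- The class modulo boundaries of the ordered edge `(u, v)`. -/
def edgeClass (L : AddSubgroup M) (u v : M) : EdgeClass L :=
  QuotientAddGroup.mk' _ (FreeAbelianGroup.of (ordMk L ![u, v]))

theorem edgeClass_cocycle (u v w : M) :
    edgeClass L v w - edgeClass L u w + edgeClass L u v = 0 := by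
  simp only [edgeClass, ← map_sub, ← map_add, ← altBdry_triangle]
  exact (QuotientAddGroup.eq_zero_iff _).mpr ⟨_, rfl⟩

theorem edgeClass_translate {a : M} (ha : a ∈ L) (u v : M) :
    edgeClass L (u + a) (v + a) = edgeClass L u v := by
  unfold edgeClass
  rw [ordMk_eq_ordMk (u := ![u, v]) (u' := ![u + a, v + a]) ha]
  intro i; fin_cases i <;> rfl

/-- The cocycle relation for the triangle (0, u, v): the function `edgeClass L 0` is a potential for
all edge classes. -/
theorem edgeClass_eq_sub (u v : M) :
    edgeClass L u v = edgeClass L 0 v - edgeClass L 0 u := by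
  have := edgeClass_cocycle (L := L) 0 u v
  rw [eq_sub_iff_add_eq, ← sub_eq_zero]
  rw [← this]; abel

theorem edgeClass_zero_zero : edgeClass L 0 0 = 0 := by
  simpa using edgeClass_cocycle (L := L) 0 0 0

/-- The potential does not descend to the quotient by `L`: invariance of edge classes under
translation only gives quasi-periodicity, with period the class of the loop (0, a). -/
theorem edgeClass_zero_add {a : M} (ha : a ∈ L) (u : M) :
    edgeClass L 0 (u + a) = edgeClass L 0 u + edgeClass L 0 a := by
  have h := edgeClass_translate ha 0 u
  rw [zero_add, edgeClass_eq_sub] at h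
  rw [← h]; abel

/-- The classes of `(u, v)` and `(-u, -v)` add up to a difference of values of this function,
which is invariant under translations. -/
def symPotential (L : AddSubgroup M) (u : M) : EdgeClass L :=
  edgeClass L 0 u + edgeClass L 0 (-u)

theorem edgeClass_add_edgeClass_neg (u v : M) :
    edgeClass L u v + edgeClass L (-u) (-v) = symPotential L v - symPotential L u := by
  rw [edgeClass_eq_sub u, edgeClass_eq_sub (-u), symPotential, symPotential]; abel

/-- The periods of the two summands are the classes of (0, a) and (0, -a), and these cancel since
they add up to the class of (0, 0). This is why the Ceresa cycle, unlike the image of the curve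
itself, is filled by this argument. -/
theorem symPotential_add {a : M} (ha : a ∈ L) (u : M) :
    symPotential L (u + a) = symPotential L u := by
  have h := edgeClass_zero_add ha (-a)
  rw [neg_add_cancel, edgeClass_zero_zero] at h
  rw [symPotential, neg_add, edgeClass_zero_add ha, edgeClass_zero_add (L.neg_mem ha), symPotential,
    eq_comm, ← add_zero (_ + _), h]
  abel

end Ordered

/-! ### The third exterior power -/

section Wedge

variable {A : Type*} [CommRing A] {M : Type*} [AddCommGroup M] [Module A M]

theorem wedge_add_left (a a' b c : M) :
    wedge A (a + a') b c = wedge A a b c + wedge A a' b c :=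
  MultilinearMap.cons_add (exteriorPower.ιMulti A 3 (M := M)).toMultilinearMap ![b, c] a a'

theorem wedge_smul_left (r : A) (a b c : M) : wedge A (r • a) b c = r • wedge A a b c :=
  MultilinearMap.cons_smul (exteriorPower.ιMulti A 3 (M := M)).toMultilinearMap ![b, c] r a

theorem wedge_swap_left (a b c : M) : wedge A a b c = -wedge A b a c := by
  have h := (exteriorPower.ιMulti A 3 (M := M)).map_swap ![b, a, c]
    (i := 0) (j := 1) (by decide)
  rw [wedge, wedge, ← h]
  congr 1
  ext i; fin_cases i <;> rfl

theorem wedge_swap_right (a b c : M) : wedge A a b c = -wedge A a c b := by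
  have h := (exteriorPower.ιMulti A 3 (M := M)).map_swap ![a, c, b]
    (i := 1) (j := 2) (by decide)
  rw [wedge, wedge, ← h]
  congr 1
  ext i; fin_cases i <;> rfl

@[simp] theorem wedge_self_left (a b : M) : wedge A a a b = 0 :=
  (exteriorPower.ιMulti A 3 (M := M)).map_eq_zero_of_eq ![a, a, b] (i := 0) (j := 1) rfl
    (by decide)

@[simp] theorem wedge_self_right (a b : M) : wedge A a b b = 0 :=
  (exteriorPower.ιMulti A 3 (M := M)).map_eq_zero_of_eq ![a, b, b] (i := 1) (j := 2) rfl
    (by decide)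

theorem wedge_add_mid (a b b' c : M) :
    wedge A a (b + b') c = wedge A a b c + wedge A a b' c := by
  rw [wedge_swap_left, wedge_add_left, neg_add, ← wedge_swap_left, ← wedge_swap_left]

theorem wedge_smul_mid (r : A) (a b c : M) : wedge A a (r • b) c = r • wedge A a b c := by
  rw [wedge_swap_left, wedge_smul_left, wedge_swap_left a b c]
  exact (smul_neg r _).symm

theorem wedge_add_right (a b c c' : M) :
    wedge A a b (c + c') = wedge A a b c + wedge A a b c' := by
  rw [wedge_swap_right, wedge_add_mid, neg_add, ← wedge_swap_right, ← wedge_swap_right]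

theorem wedge_smul_right (r : A) (a b c : M) : wedge A a b (r • c) = r • wedge A a b c := by
  rw [wedge_swap_right, wedge_smul_mid, wedge_swap_right a b c]
  exact (smul_neg r _).symm

theorem wedge_neg_mid (a b c : M) : wedge A a (-b) c = -wedge A a b c := by
  rw [← neg_one_smul A b, wedge_smul_mid]
  exact neg_one_smul A (wedge A a b c)

theorem wedge_neg_right (a b c : M) : wedge A a b (-c) = -wedge A a b c := by
  rw [← neg_one_smul A c, wedge_smul_right]
  exact neg_one_smul A (wedge A a b c)

theorem wedge_sub_mid (a b b' c : M) :
    wedge A a (b - b') c = wedge A a b c - wedge A a b' c := by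
  rw [sub_eq_add_neg, wedge_add_mid, wedge_neg_mid, sub_eq_add_neg]

theorem wedge_sub_right (a b c c' : M) :
    wedge A a b (c - c') = wedge A a b c - wedge A a b c' := by
  rw [sub_eq_add_neg, wedge_add_right, wedge_neg_right, sub_eq_add_neg]

@[simp] theorem wedge_zero_left (a c : M) : wedge A 0 a c = 0 := by
  simpa using wedge_smul_left (0 : A) 0 a c

/-- The area of a triangle whose vertices are moved by `k₀, k₁, k₂` changes by a coboundary. -/
theorem wedge_move_vertices (n u₀ u₁ u₂ k₀ k₁ k₂ : M) :
    wedge A n ((u₁ + k₁) - (u₀ + k₀)) ((u₂ + k₂) - (u₀ + k₀)) =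
      wedge A n (u₁ - u₀) (u₂ - u₀) +
        ((wedge A n k₁ k₂ - wedge A n (u₂ - u₁) (k₁ + k₂)) -
          (wedge A n k₀ k₂ - wedge A n (u₂ - u₀) (k₀ + k₂)) +
          (wedge A n k₀ k₁ - wedge A n (u₁ - u₀) (k₀ + k₁))) := by
  simp only [wedge_add_mid, wedge_add_right, wedge_sub_mid, wedge_sub_right, wedge_self_right]
  rw [wedge_swap_right n k₁ u₂, wedge_swap_right n k₁ u₀, wedge_swap_right n k₀ u₂,
    wedge_swap_right n k₁ k₀]
  rw [wedge_swap_right n k₀ u₀]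
  abel

end Wedge

/-! ### The cycle relation among the functionals n_e. -/

namespace MGraph

variable {V E : Type*} (G : MGraph V E)

section Basic

variable {G}

theorem N.sum_apply {ι : Type*} (s : Finset ι) (n : ι → G.N) (γ : G.H1) :
    (∑ i ∈ s, n i) γ = ∑ i ∈ s, n i γ :=
  AddMonoidHom.finsetSum_apply (M := G.H1) (N := ℤ) n s γ

theorem N.zsmul_apply (k : ℤ) (n : G.N) (γ : G.H1) : (k • n) γ = k * n γ :=
  (map_zsmul (⟨⟨fun n : G.N => n γ, rfl⟩, fun _ _ => rfl⟩ : G.N →+ ℤ) k n).trans (smul_eq_mul k _)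

@[simp] theorem Coh.neg_apply {A : Type*} [CommRing A] (u : G.Coh A) (γ : G.H1) :
    (-u) γ = -u γ := rfl

@[simp] theorem Coh.sub_apply {A : Type*} [CommRing A] (u u' : G.Coh A) (γ : G.H1) :
    (u - u') γ = u γ - u' γ := rfl

end Basic

theorem bdry_single (e : E) : G.bdry (Finsupp.single e 1) =
    Finsupp.single (G.head e) 1 - Finsupp.single (G.tail e) 1 := by
  simp [bdry]

theorem bdry_path (v w : V) :
    G.bdry (G.path v w) = Finsupp.single w 1 - Finsupp.single v 1 :=
  (G.exists_path v w).choose_spec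

variable [Fintype E]

theorem bdry_apply_eq_sum (c : E →₀ ℤ) (w : V) :
    G.bdry c w = ∑ e, c e * G.bdry (Finsupp.single e 1) w := by
  rw [bdry, Finsupp.linearCombination_apply, Finsupp.sum_fintype _ _ (by simp),
    Finsupp.finsetSum_apply]
  simp

/-- The functionals `n_e` satisfy the dual of the cycle condition: the sum of the differences
of a function on the vertices, weighted by the `n_e`, vanishes. -/
theorem sum_dir_tmul_sub [Finite V] {X : Type*} [AddCommGroup X] (f : V → X) :
    ∑ e, G.dir e ⊗ₜ[ℤ] (f (G.head e) - f (G.tail e)) = 0 := by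
  classical
  cases nonempty_fintype V
  have h1 : ∀ e, f (G.head e) - f (G.tail e)
      = ∑ w, G.bdry (Finsupp.single e 1) w • f w := by
    intro e
    simp only [bdry_single, Finsupp.sub_apply, sub_smul, Finset.sum_sub_distrib,
      Finsupp.single_apply, ite_smul, one_smul, zero_smul, Finset.sum_ite_eq, Finset.mem_univ,
      if_true]
  simp only [h1, TensorProduct.tmul_sum]
  rw [Finset.sum_comm]
  refine Finset.sum_eq_zero fun w _ => ?_
  simp only [TensorProduct.tmul_smul, TensorProduct.smul_tmul']
  rw [← TensorProduct.sum_tmul]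
  -- After collecting the coefficient of `f w`, what remains is the functional ∑_e (∂e)(w) n_e,
  -- whose value on a cycle γ is (∂γ)(w) = 0.
  suffices h : ∑ e, G.bdry (Finsupp.single e 1) w • G.dir e = 0 by
    rw [h, TensorProduct.zero_tmul]
  ext γ
  rw [N.sum_apply, N.zero_apply]
  have h2 : G.bdry γ w = 0 := by
    rw [LinearMap.mem_ker.mp γ.2, Finsupp.zero_apply]
  rw [bdry_apply_eq_sum] at h2
  rw [← h2]
  exact Finset.sum_congr rfl fun e _ => by rw [N.zsmul_apply, dir_apply, mul_comm]

/-! ### Images of the graph as ordered chains: fillings, and boundaries of chains without area. -/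

section Ordered

variable {A : Type*} [CommRing A] (x : E → A)

theorem proj_mem_lattice {c : E →₀ ℤ} (hc : G.bdry c = 0) : G.proj x c ∈ G.lattice x :=
  ⟨c, hc, rfl⟩

theorem uBdry_eq_bdryChain (q : ℕ) : G.uBdry x q = bdryChain G.N (ordFace (G.lattice x)) := rfl

/-- The functional `n ↦ n ∧ (u₁ - u₀) ∧ (u₂ - u₀)` of an ordered `2`-simplex modulo `Λ`. -/
def ordArea (s : OrdSimplex (G.lattice x) 2) : G.N →ₗ[ℤ] ⋀[A]^3 (G.Coh A) :=
  Quotient.liftOn s G.uThetaFun (by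
      rintro u u' ⟨l, -, h⟩
      have h1 : u' 1 - u' 0 = u 1 - u 0 := by rw [h 1, h 0]; abel
      have h2 : u' 2 - u' 0 = u 2 - u 0 := by rw [h 2, h 0]; abel
      ext1 n
      simp [uThetaFun, h1, h2])

theorem uTheta_eq_evalChain : G.uTheta x = evalChain (G.ordArea x) := rfl

theorem ordArea_ordMk (u : Fin 3 → G.Coh A) (n : G.N) :
    G.ordArea x (ordMk _ u) n = wedge A (G.toCoh A n) (u 1 - u 0) (u 2 - u 0) := rfl

/-- The chain `∑ n_e ⊗ (u₀(e), u₁(e))`. -/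
def edgeChain (u₀ u₁ : E → G.Coh A) : G.UChain x 1 :=
  ∑ e, G.dir e ⊗ₜ[ℤ] FreeAbelianGroup.of (ordMk (G.lattice x) ![u₀ e, u₁ e])

variable {x} {G}

/-- `u₀` and `u₁` describe the endpoints of the images of the edges under a map
`f : V → N_A / Λ`. -/
structure IsEdgeLift (x : E → A) (f : V → G.Coh A) (u₀ u₁ : E → G.Coh A) : Prop where
  tail_mem : ∀ e, u₀ e - f (G.tail e) ∈ G.lattice x
  head_mem : ∀ e, u₁ e - f (G.head e) ∈ G.lattice x

theorem IsEdgeLift.neg {f : V → G.Coh A} {u₀ u₁ : E → G.Coh A} (h : IsEdgeLift x f u₀ u₁) :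
    IsEdgeLift x (fun v => -f v) (fun e => -u₀ e) (fun e => -u₁ e) where
  tail_mem e := by
    have := neg_mem (h.tail_mem e)
    rwa [neg_sub, sub_eq_neg_add, ← sub_neg_eq_add] at this
  head_mem e := by
    have := neg_mem (h.head_mem e)
    rwa [neg_sub, sub_eq_neg_add, ← sub_neg_eq_add] at this

/-- The symmetrized image of a graph is a boundary. -/
theorem IsEdgeLift.exists_uBdry_eq [Finite V] {f : V → G.Coh A} {u₀ u₁ : E → G.Coh A}
    (h : IsEdgeLift x f u₀ u₁) :
    ∃ S, G.uBdry x 1 S =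
      G.edgeChain x u₀ u₁ + G.edgeChain x (fun e => -u₀ e) (fun e => -u₁ e) := by
  refine exists_bdryChain_eq (N := G.N) (ordFace (G.lattice x)) _ ?_
  -- The lifts of the endpoints may vary from edge to edge; the potential sees only their classes
  -- modulo Λ, hence depends only on the vertices.
  have key : ∀ e, edgeClass (G.lattice x) (u₀ e) (u₁ e) +
      edgeClass (G.lattice x) (-u₀ e) (-u₁ e) =
      symPotential (G.lattice x) (f (G.head e)) - symPotential (G.lattice x) (f (G.tail e)) := by
    intro e
    rw [edgeClass_add_edgeClass_neg, ← symPotential_add (h.tail_mem e) (f (G.tail e)),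
      ← symPotential_add (h.head_mem e) (f (G.head e)), add_sub_cancel, add_sub_cancel]
  rw [← G.sum_dir_tmul_sub (fun v => symPotential (G.lattice x) (f v)), edgeChain, edgeChain,
    map_add, map_sum, map_sum, ← Finset.sum_add_distrib]
  refine Finset.sum_congr rfl fun e _ => ?_
  rw [LinearMap.lTensor_tmul, LinearMap.lTensor_tmul, ← TensorProduct.tmul_add, ← key]
  rfl

theorem uTheta_tmul_of (n : G.N) (u v w : G.Coh A) :
    G.uTheta x (n ⊗ₜ FreeAbelianGroup.of (ordMk _ ![u, v, w])) =
      wedge A (G.toCoh A n) (v - u) (w - u) := by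
  rw [uTheta_eq_evalChain, evalChain_tmul_of, ordArea_ordMk]
  rfl

theorem uBdry_tmul_of (n : G.N) (u v w : G.Coh A) :
    G.uBdry x 1 (n ⊗ₜ FreeAbelianGroup.of (ordMk _ ![u, v, w])) =
      n ⊗ₜ[ℤ] (FreeAbelianGroup.of (ordMk _ ![v, w]) - FreeAbelianGroup.of (ordMk _ ![u, w]) +
        FreeAbelianGroup.of (ordMk _ ![u, v])) := by
  rw [uBdry_eq_bdryChain, bdryChain_tmul, altBdry_triangle]

variable (G x) in
/-- The boundaries of the chains of area zero. -/
def flatBdry : AddSubgroup (G.UChain x 1) := (G.uTheta x).ker.map (G.uBdry x 1)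

/-- Translating the image of a graph whose edges are parallel to the `n_e` changes it by the
boundary of a prism without area. -/
theorem IsEdgeLift.sub_translate_mem [Finite V] {f : V → G.Coh A} {u₀ u₁ : E → G.Coh A}
    (h : IsEdgeLift x f u₀ u₁) (hpar : ∀ e, ∃ c : A, u₁ e - u₀ e = c • G.toCoh A (G.dir e))
    (w : G.Coh A) :
    G.edgeChain x u₀ u₁ - G.edgeChain x (fun e => u₀ e + w) (fun e => u₁ e + w) ∈
      G.flatBdry x := by
  -- The parallelogram swept out by each edge, cut along the diagonal from u₀ to u₁ + w. Both
  -- triangles contain a side parallel to n_e, so wedging with n_e gives zero.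
  refine ⟨∑ e, (G.dir e ⊗ₜ[ℤ] FreeAbelianGroup.of (ordMk _ ![u₀ e, u₁ e, u₁ e + w]) -
    G.dir e ⊗ₜ[ℤ] FreeAbelianGroup.of (ordMk _ ![u₀ e, u₀ e + w, u₁ e + w])), ?_, ?_⟩
  · rw [SetLike.mem_coe, AddMonoidHom.mem_ker, map_sum]
    refine Finset.sum_eq_zero fun e _ => ?_
    obtain ⟨c, hc⟩ := hpar e
    rw [map_sub, uTheta_tmul_of, uTheta_tmul_of, hc, add_sub_cancel_left, add_sub_right_comm, hc,
      wedge_smul_mid, wedge_self_left, wedge_add_right, wedge_smul_right, wedge_swap_right,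
      wedge_self_left, wedge_self_right]
    simp
  -- The sides (f, f + w) swept out by the vertices cancel by the cycle relation; without it they
  -- would remain in the boundary.
  · have hv := G.sum_dir_tmul_sub
      (fun v => FreeAbelianGroup.of (ordMk (G.lattice x) ![f v, f v + w]))
    rw [← add_zero (_ - _), ← hv, edgeChain, edgeChain, map_sum, ← Finset.sum_sub_distrib,
      ← Finset.sum_add_distrib]
    refine Finset.sum_congr rfl fun e _ => ?_
    have h0 : ordMk (G.lattice x) ![f (G.tail e), f (G.tail e) + w] =
        ordMk (G.lattice x) ![u₀ e, u₀ e + w] := by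
      refine ordMk_eq_ordMk (h.tail_mem e) fun i => ?_
      fin_cases i
      · simp
      · simp; abel
    have h1 : ordMk (G.lattice x) ![f (G.head e), f (G.head e) + w] =
        ordMk (G.lattice x) ![u₁ e, u₁ e + w] := by
      refine ordMk_eq_ordMk (h.head_mem e) fun i => ?_
      fin_cases i
      · simp
      · simp; abel
    rw [map_sub, uBdry_tmul_of, uBdry_tmul_of, h0, h1]
    simp only [TensorProduct.tmul_add, TensorProduct.tmul_sub]
    abel

/-- Subdividing the image of an edge parallel to `n_e` changes it by the boundary of a triangle
without area. -/
theorem subdivision_mem_flatBdry (e : E) {u v : G.Coh A} (w : G.Coh A) {c : A}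
    (hc : v - u = c • G.toCoh A (G.dir e)) :
    (G.dir e ⊗ₜ[ℤ] FreeAbelianGroup.of (ordMk _ ![u, v]) +
      G.dir e ⊗ₜ[ℤ] FreeAbelianGroup.of (ordMk _ ![v, w])) -
      G.dir e ⊗ₜ[ℤ] FreeAbelianGroup.of (ordMk _ ![u, w]) ∈ G.flatBdry x := by
  refine ⟨G.dir e ⊗ₜ[ℤ] FreeAbelianGroup.of (ordMk _ ![u, v, w]), ?_, ?_⟩
  · rw [SetLike.mem_coe, AddMonoidHom.mem_ker, uTheta_tmul_of, hc, wedge_smul_mid,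
      wedge_self_left, smul_zero]
  · rw [uBdry_tmul_of]
    simp only [TensorProduct.tmul_add, TensorProduct.tmul_sub]
    abel

theorem edgeChain_congr {u₀ u₁ u₀' u₁' : E → G.Coh A}
    (h : ∀ e, ∃ a ∈ G.lattice x, u₀' e = u₀ e + a ∧ u₁' e = u₁ e + a) :
    G.edgeChain x u₀ u₁ = G.edgeChain x u₀' u₁' := by
  refine Finset.sum_congr rfl fun e _ => ?_
  obtain ⟨a, ha, h0, h1⟩ := h e
  rw [ordMk_eq_ordMk (u' := ![u₀' e, u₁' e]) ha]
  intro i; fin_cases i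
  · exact h0
  · exact h1

/-! ### Ceresa cycles -/

theorem proj_bdry_congr {c d : E →₀ ℤ} (h : G.bdry c = G.bdry d) :
    G.proj x c - G.proj x d ∈ G.lattice x := by
  rw [← map_sub]
  exact G.proj_mem_lattice x (by rw [map_sub, h, sub_self])

/-- A path to e⁻ followed by e and a path to e⁺ differ by a cycle, so their images differ by an
element of Λ. The offset `o` allows for base points inside an edge. -/
theorem isEdgeLift_path (v : V) (o : G.Coh A) :
    IsEdgeLift x (fun w => G.proj x (G.path v w) + o)
      (fun e => G.proj x (G.path v (G.tail e)) + o)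
      (fun e => G.proj x (G.path v (G.tail e) + Finsupp.single e 1) + o) where
  tail_mem e := by simp
  head_mem e := by
    rw [add_sub_add_right_eq_sub]
    refine proj_bdry_congr ?_
    rw [map_add, bdry_path, bdry_path, bdry_single]
    abel

-- The inversion acts by -1 on N as well, which turns the difference Φ - [-1]_*Φ into a sum of two
-- edge chains.
variable (G x) in
theorem uCer_eq_edgeChain (v : V) : G.uCer x v =
    G.edgeChain x (fun e => G.proj x (G.path v (G.tail e)))
      (fun e => G.proj x (G.path v (G.tail e) + Finsupp.single e 1)) +
    G.edgeChain x (fun e => -G.proj x (G.path v (G.tail e)))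
      (fun e => -G.proj x (G.path v (G.tail e) + Finsupp.single e 1)) := by
  rw [uCer, edgeChain, edgeChain, map_sum, sub_eq_add_neg, ← Finset.sum_neg_distrib]
  congr 1
  refine Finset.sum_congr rfl fun e _ => ?_
  have : G.uNeg x 1 (G.uPhi x v e) = (-G.dir e) ⊗ₜ[ℤ] FreeAbelianGroup.map
      (ordNeg (G.lattice x)) (FreeAbelianGroup.of (ordMk (G.lattice x)
      ![G.proj x (G.path v (G.tail e)),
        G.proj x (G.path v (G.tail e) + Finsupp.single e 1)])) := rfl
  rw [this, FreeAbelianGroup.map_of_apply, ordNeg_ordMk, TensorProduct.neg_tmul, neg_neg]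
  congr 3
  ext i : 1; fin_cases i <;> rfl

variable (G x) in
theorem exists_uBdry_eq_uCer [Finite V] (v : V) : ∃ S, G.uBdry x 1 S = G.uCer x v := by
  rw [uCer_eq_edgeChain]
  simpa using (isEdgeLift_path (x := x) v (0 : G.Coh A)).exists_uBdry_eq

/-- The translate by `o` of the symmetrized image of the graph under the Abel-Jacobi map based at
`w` agrees, up to boundaries of chains of area zero, with the Ceresa cycle based at `v`. -/
theorem translate_sub_uCer_mem [Finite V] (v w : V) (o : G.Coh A) :
    (G.edgeChain x (fun e => G.proj x (G.path w (G.tail e)) + o)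
      (fun e => G.proj x (G.path w (G.tail e) + Finsupp.single e 1) + o) +
    G.edgeChain x (fun e => -(G.proj x (G.path w (G.tail e)) + o))
      (fun e => -(G.proj x (G.path w (G.tail e) + Finsupp.single e 1) + o))) - G.uCer x v ∈
      G.flatBdry x := by
  have hpar : ∀ e, (G.proj x (G.path w (G.tail e) + Finsupp.single e 1) + o) -
      (G.proj x (G.path w (G.tail e)) + o) = x e • G.toCoh A (G.dir e) := by
    intro e
    rw [map_add, smul_dir]; abel
  have hmem : ∀ e, G.proj x (G.path v (G.tail e)) -
      (G.proj x (G.path w (G.tail e)) + G.proj x (G.path v w)) ∈ G.lattice x := by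
    intro e
    rw [← map_add]
    refine proj_bdry_congr ?_
    rw [map_add, bdry_path, bdry_path, bdry_path]
    abel
  -- The two halves of the cycle are moved by opposite vectors. Translation by `proj (path v w) - o`
  -- removes the offset and replaces the base vertex w by v, up to Λ.
  have h1 := (isEdgeLift_path (x := x) w o).sub_translate_mem (fun e => ⟨_, hpar e⟩)
    (G.proj x (G.path v w) - o)
  have h2 := (isEdgeLift_path (x := x) w o).neg.sub_translate_mem
    (fun e => ⟨-x e, by rw [neg_smul, ← hpar]; abel⟩) (-(G.proj x (G.path v w) - o))
  rw [edgeChain_congr (u₀ := fun e => _ + (G.proj x (G.path v w) - o))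
    (u₀' := fun e => G.proj x (G.path v (G.tail e)))
    (u₁' := fun e => G.proj x (G.path v (G.tail e) + Finsupp.single e 1))
    (fun e => ⟨_, hmem e, by abel, by rw [map_add, map_add]; abel⟩)] at h1
  rw [edgeChain_congr (u₀ := fun e => _ + -(G.proj x (G.path v w) - o))
    (u₀' := fun e => -G.proj x (G.path v (G.tail e)))
    (u₁' := fun e => -G.proj x (G.path v (G.tail e) + Finsupp.single e 1))
    (fun e => ⟨_, neg_mem (hmem e), by abel, by rw [map_add, map_add]; abel⟩)] at h2
  rw [uCer_eq_edgeChain]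
  have h := add_mem h1 h2
  rwa [← add_sub_add_comm] at h

end Ordered

end MGraph

/-! ### Evaluation of functionals and of wedge products. -/

namespace MGraph

variable {V E : Type*} (G : MGraph V E)

theorem evRing_X (l : E → ℝ) (e : E) : evRing l (MvPolynomial.X e) = l e := by
  simp [evRing]

theorem evCoh_toCoh (l : E → ℝ) (n : G.N) : G.evCoh l (G.toCoh _ n) = G.toCoh ℝ n := by
  ext γ
  change evRing l (G.toCoh _ n γ) = _
  simp [evRing]

theorem evExt_wedge (l : E → ℝ) (a b c : G.Coh (MvPolynomial E ℤ)) :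
    G.evExt l (wedge _ a b c) = wedge ℝ (G.evCoh l a) (G.evCoh l b) (G.evCoh l c) := by
  change extMap (evRing l) 3 (G.evCoh l) _ = _
  rw [wedge, extMap_ιMulti, wedge]
  congr 1
  ext i : 1; fin_cases i <;> rfl

/-! ### Invariance of periods under equivariant maps -/

/-- For a map `ρ` commuting with translations by `Λ`, the cochain whose coboundary is the change
of area under `ρ`. -/
def areaHomotopyFun {A : Type*} [CommRing A] (ρ : G.Coh A → G.Coh A) (u : Fin 2 → G.Coh A) :
    G.N →ₗ[ℤ] ⋀[A]^3 (G.Coh A) :=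
  AddMonoidHom.toIntLinearMap
    { toFun := fun n => wedge A (G.toCoh A n) (ρ (u 0) - u 0) (ρ (u 1) - u 1) -
        wedge A (G.toCoh A n) (u 1 - u 0) ((ρ (u 0) - u 0) + (ρ (u 1) - u 1))
      map_zero' := by simp
      map_add' := fun n n' => by
        rw [map_add, wedge_add_left, wedge_add_left]
        abel }

theorem areaHomotopyFun_apply {A : Type*} [CommRing A] (ρ : G.Coh A → G.Coh A)
    (u : Fin 2 → G.Coh A) (n : G.N) :
    G.areaHomotopyFun ρ u n = wedge A (G.toCoh A n) (ρ (u 0) - u 0) (ρ (u 1) - u 1) -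
        wedge A (G.toCoh A n) (u 1 - u 0) ((ρ (u 0) - u 0) + (ρ (u 1) - u 1)) := rfl

variable [Fintype E]

section Equivariant

variable {A : Type*} [CommRing A] (x : E → A)

/-- `areaHomotopyFun` on ordered edges modulo `Λ`. -/
def areaHomotopy (ρ : G.Coh A → G.Coh A) (hρ : ∀ a ∈ G.lattice x, ∀ u, ρ (u + a) = ρ u + a)
    (s : OrdSimplex (G.lattice x) 1) : G.N →ₗ[ℤ] ⋀[A]^3 (G.Coh A) :=
  Quotient.liftOn s (G.areaHomotopyFun ρ) (by
      rintro u u' ⟨a, ha, h⟩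
      ext1 n
      simp only [areaHomotopyFun_apply, h, hρ a ha, add_sub_add_right_eq_sub])

variable {G x} in
/-- Maps commuting with translations by `Λ` do not change the values of `Θ` on cycles. -/
theorem uTheta_pushChain_of_equivariant (ρ : G.Coh A → G.Coh A)
    (hρ : ∀ a ∈ G.lattice x, ∀ u, ρ (u + a) = ρ u + a) (f : OrdSimplex (G.lattice x) 2 → _)
    (hf : ∀ u, f (ordMk _ u) = ordMk (G.lattice x) (fun i => ρ (u i)))
    {c : G.UChain x 2} (hc : G.uBdry x 1 c = 0) :
    G.uTheta x (pushChain G.N f c) = G.uTheta x c := by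
  rw [uTheta_eq_evalChain, evalChain_pushChain, evalChain_add_coboundary (θ := G.ordArea x)
    (face := ordFace (G.lattice x)) (G.areaHomotopy x ρ hρ), ← uBdry_eq_bdryChain, hc, map_zero,
    add_zero]
  intro s n
  induction s using Quotient.inductionOn with
  | h u =>
    have key := wedge_move_vertices (A := A) (G.toCoh A n) (u 0) (u 1) (u 2) (ρ (u 0) - u 0)
      (ρ (u 1) - u 1) (ρ (u 2) - u 2)
    simp only [add_sub_cancel] at key
    change G.ordArea x (f (ordMk _ u)) n = G.ordArea x (ordMk _ u) n + _
    rw [hf, ordArea_ordMk, ordArea_ordMk, key, Fin.sum_univ_three]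
    simp only [Fin.val_zero, Fin.val_one, Fin.val_two, pow_zero, pow_one, one_smul, neg_smul,
      neg_one_sq, ← sub_eq_add_neg]
    rfl

end Equivariant

/-! ### Evaluation -/

section Evaluation

variable (l : E → ℝ)

theorem evCoh_proj (c : E →₀ ℤ) : G.evCoh l (G.proj (vars E) c) = G.proj l c := by
  ext γ
  change evRing l (G.proj (vars E) c γ) = _
  simp [pairing, evRing_X]

theorem evCoh_equivariant : ∀ a ∈ G.lattice (vars E), ∃ a' ∈ G.lattice l,
    ∀ u, G.evCoh l (u + a) = G.evCoh l u + a' := by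
  rintro _ ⟨c, hc, rfl⟩
  exact ⟨G.proj l c, ⟨c, hc, rfl⟩, fun u => by rw [map_add, evCoh_proj]⟩

/-- Evaluation of ordered chains. -/
def evChain (q : ℕ) : G.UChain (vars E) q →+ G.UChain l q :=
  pushChain G.N (ordMap (G.evCoh l) (G.evCoh_equivariant l))

theorem uBdry_evChain (q : ℕ) (c : G.UChain (vars E) (q + 1)) :
    G.uBdry l q (G.evChain l (q + 1) c) = G.evChain l q (G.uBdry (vars E) q c) :=
  bdryChain_pushChain (ordFace_ordMap _ _) c

theorem uTheta_evChain (c : G.UChain (vars E) 2) :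
    G.uTheta l (G.evChain l 2 c) = G.evExt l (G.uTheta (vars E) c) := by
  rw [uTheta_eq_evalChain, evChain, evalChain_pushChain, uTheta_eq_evalChain]
  refine (map_evalChain _ _ _ (fun s n => ?_) c).symm
  induction s using Quotient.inductionOn with
  | h u =>
    change G.evExt l (G.ordArea _ (ordMk _ u) n) = G.ordArea l (ordMap _ _ (ordMk _ u)) n
    rw [ordMap_ordMk, ordArea_ordMk, ordArea_ordMk, evExt_wedge, evCoh_toCoh, map_sub, map_sub]

theorem evChain_edgeChain (u₀ u₁ : E → G.Coh (MvPolynomial E ℤ)) :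
    G.evChain l 1 (G.edgeChain (vars E) u₀ u₁) =
      G.edgeChain l (fun e => G.evCoh l (u₀ e)) (fun e => G.evCoh l (u₁ e)) := by
  rw [edgeChain, edgeChain, map_sum]
  refine Finset.sum_congr rfl fun e _ => ?_
  rw [evChain, pushChain_tmul, FreeAbelianGroup.map_of_apply, ordMap_ordMk]
  congr 3
  ext i : 1; fin_cases i <;> rfl

theorem evChain_uCer (v : V) : G.evChain l 1 (G.uCer (vars E) v) = G.uCer l v := by
  rw [uCer_eq_edgeChain, uCer_eq_edgeChain, map_add, evChain_edgeChain, evChain_edgeChain]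
  simp only [map_neg, evCoh_proj]

variable {l}

/-- Evaluating π(c) on c itself gives [c, c] = ∑ c_e² l(e), which is positive unless c = 0. -/
theorem proj_injOn_H1 (hl : ∀ e, 0 < l e) {c : E →₀ ℤ} (hc : c ∈ G.H1) (h : G.proj l c = 0) :
    c = 0 := by
  have h0 : ∑ e, ((c e * c e : ℤ) : ℝ) * l e = 0 := by
    have := DFunLike.congr_fun h (⟨c, hc⟩ : G.H1)
    simpa [pairing] using this
  ext e
  have h1 := (Finset.sum_eq_zero_iff_of_nonneg (fun e _ => by
    have : (0 : ℝ) ≤ ((c e * c e : ℤ) : ℝ) := by exact_mod_cast mul_self_nonneg (c e)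
    exact mul_nonneg this (hl e).le)).mp h0 e (Finset.mem_univ e)
  have h2 : ((c e * c e : ℤ) : ℝ) = 0 := (mul_eq_zero.mp h1).resolve_right (hl e).ne'
  exact mul_self_eq_zero.mp (by exact_mod_cast h2)

/-- An equivariant map from `N_ℝ` to the cycles of the graph. -/
theorem exists_equivariant (hl : ∀ e, 0 < l e) : ∃ κ : G.Coh ℝ → (E →₀ ℤ),
    (∀ u, κ u ∈ G.H1) ∧ ∀ c ∈ G.H1, ∀ u, κ (u + G.proj l c) = κ u + c := by
  -- Fix a representative of every class in the Jacobian; κ(u) is the cycle that carries the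
  -- representative to u. It is unique by injectivity of π on H₁, and this makes κ equivariant on
  -- the nose.
  have h : ∀ u : G.Coh ℝ, ∃ c ∈ G.H1,
      G.proj l c = u - Quotient.out (QuotientAddGroup.mk u : G.Jac l) := by
    intro u
    have h1 : -(Quotient.out (QuotientAddGroup.mk u : G.Jac l)) + u ∈ G.lattice l :=
      QuotientAddGroup.eq.mp (QuotientAddGroup.out_eq' _)
    obtain ⟨c, hc, h2⟩ := h1
    exact ⟨c, hc, by rw [h2]; abel⟩
  choose κ hκ hκ' using h
  refine ⟨κ, hκ, fun c hc u => ?_⟩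
  rw [← sub_eq_zero]
  refine G.proj_injOn_H1 hl (sub_mem (hκ _) (add_mem (hκ _) hc)) ?_
  have h3 : (QuotientAddGroup.mk (u + G.proj l c) : G.Jac l) = QuotientAddGroup.mk u :=
    QuotientAddGroup.mk_add_of_mem u ⟨c, hc, rfl⟩
  rw [map_sub, map_add, hκ', hκ', h3]
  abel

/-- The evaluations of the universal periods are the periods of ordered chains over `ℝ`. -/
theorem map_uPeriods (hl : ∀ e, 0 < l e) :
    (G.uPeriods (vars E)).map (G.evExt l) = G.uPeriods l := by
  apply le_antisymm
  · rintro _ ⟨_, ⟨c, hc, rfl⟩, rfl⟩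
    refine ⟨G.evChain l 2 c, ?_, G.uTheta_evChain l c⟩
    rw [SetLike.mem_coe, AddMonoidHom.mem_ker] at hc ⊢
    rw [uBdry_evChain, hc, map_zero]
  · rintro _ ⟨c, hc, rfl⟩
    rw [SetLike.mem_coe, AddMonoidHom.mem_ker] at hc
    -- Replacing each vertex u by the universal π(κ(u)) lifts real ordered simplices to universal
    -- ones. After evaluation the vertices have been moved by ρ = π_C ∘ κ, which commutes with
    -- translations by Λ_C and so preserves Θ on cycles.
    obtain ⟨κ, hκ, hκ'⟩ := G.exists_equivariant hl
    have hf : ∀ a ∈ G.lattice l, ∃ a' ∈ G.lattice (vars E), ∀ u,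
        G.proj (vars E) (κ (u + a)) = G.proj (vars E) (κ u) + a' := by
      rintro _ ⟨d, hd, rfl⟩
      exact ⟨G.proj _ d, ⟨d, hd, rfl⟩, fun u => by rw [hκ' d hd, map_add]⟩
    refine ⟨_, ⟨pushChain G.N (ordMap (fun u => G.proj (vars E) (κ u)) hf) c, ?_, rfl⟩, ?_⟩
    · rw [SetLike.mem_coe, AddMonoidHom.mem_ker, uBdry_eq_bdryChain,
        bdryChain_pushChain (ordFace_ordMap _ _), ← uBdry_eq_bdryChain, hc, map_zero]
    · rw [← uTheta_evChain, evChain, pushChain_pushChain]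
      refine uTheta_pushChain_of_equivariant (fun u => G.proj l (κ u)) ?_ _ ?_ hc
      · rintro _ ⟨d, hd, rfl⟩ u
        rw [hκ' d hd, map_add]
      · intro u
        rw [ordMap_ordMk, ordMap_ordMk]
        simp only [evCoh_proj]

/-! ### The tropical Ceresa cycle as an ordered chain -/

variable (l) in
/-- The tropical Ceresa cycle, as a chain of ordered simplices. -/
def ordCer (p : Point (V := V) l) : G.UChain l 1 :=
  ∑ e, ((segments l p e).map fun s => G.dir e ⊗ₜ[ℤ]
    (FreeAbelianGroup.of
      (ordMk (G.lattice l) ![G.abelJacobi l p e s.1, G.abelJacobi l p e s.2]) +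
      FreeAbelianGroup.of
        (ordMk (G.lattice l) ![-G.abelJacobi l p e s.1, -G.abelJacobi l p e s.2]))).sum

theorem abelJacobi_sub (p : Point (V := V) l) (e : E) (a a' : ℝ) :
    G.abelJacobi l p e a' - G.abelJacobi l p e a = (a' - a) • G.toCoh ℝ (G.dir e) := by
  rw [abelJacobi, abelJacobi, sub_smul]; abel

/-- Only the edge containing the base point is subdivided. There the two pieces and the whole edge
bound a degenerate triangle, once for each sign. -/
theorem segments_sub_mem (p : Point (V := V) l) (e : E) :
    ((segments l p e).map fun s => G.dir e ⊗ₜ[ℤ]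
      (FreeAbelianGroup.of
        (ordMk (G.lattice l) ![G.abelJacobi l p e s.1, G.abelJacobi l p e s.2]) +
        FreeAbelianGroup.of
          (ordMk (G.lattice l) ![-G.abelJacobi l p e s.1, -G.abelJacobi l p e s.2]))).sum -
    (G.dir e ⊗ₜ[ℤ] FreeAbelianGroup.of
        (ordMk (G.lattice l) ![G.abelJacobi l p e 0, G.abelJacobi l p e (l e)]) +
      G.dir e ⊗ₜ[ℤ] FreeAbelianGroup.of
        (ordMk (G.lattice l) ![-G.abelJacobi l p e 0, -G.abelJacobi l p e (l e)])) ∈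
      G.flatBdry l := by
  by_cases h : segments l p e = [(0, l e)]
  · rw [h]
    simp [TensorProduct.tmul_add, zero_mem]
  · obtain ⟨t, ht⟩ : ∃ t, segments l p e = [(0, t), (t, l e)] := by
      unfold segments at h ⊢
      split at h
      · exact absurd rfl h
      · split_ifs at h with h'
        · exact ⟨_, by rw [if_pos h']⟩
        · exact absurd rfl h
    rw [ht]
    have h1 := subdivision_mem_flatBdry (x := l) e (G.abelJacobi l p e (l e))
      (G.abelJacobi_sub p e 0 t)
    have h2 := subdivision_mem_flatBdry (x := l) e (u := -G.abelJacobi l p e 0)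
      (v := -G.abelJacobi l p e t) (c := -(t - 0)) (-G.abelJacobi l p e (l e))
      (by rw [neg_smul, ← G.abelJacobi_sub p e 0 t]; abel)
    have h3 := add_mem h1 h2
    convert! h3 using 1
    simp only [List.map_cons, List.map_nil, List.sum_cons, List.sum_nil, TensorProduct.tmul_add]
    abel

/-- With `abelJacobi_length`, this exhibits the unsubdivided tropical edges as the lifts of
`isEdgeLift_path` with o = -offset. -/
theorem abelJacobi_zero (p : Point (V := V) l) (e : E) : G.abelJacobi l p e 0 =
    G.proj l (G.path (G.baseVertex l p) (G.tail e)) + -G.offset l p := by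
  rw [abelJacobi, zero_smul]; abel

theorem abelJacobi_length (p : Point (V := V) l) (e : E) : G.abelJacobi l p e (l e) =
    G.proj l (G.path (G.baseVertex l p) (G.tail e) + Finsupp.single e 1) + -G.offset l p := by
  rw [abelJacobi, smul_dir, map_add]; abel

/-- The tropical Ceresa cycle agrees with the Ceresa cycle of ordered chains based at any vertex,
up to the boundary of a chain of area zero. -/
theorem ordCer_sub_uCer_mem [Finite V] (v : V) (p : Point (V := V) l) :
    G.ordCer l p - G.uCer l v ∈ G.flatBdry l := by
  have h1 := sum_mem (t := Finset.univ) fun e _ => G.segments_sub_mem p e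
  have h2 := translate_sub_uCer_mem (x := l) v (G.baseVertex l p) (-G.offset l p)
  simp only [← abelJacobi_zero, ← abelJacobi_length] at h2
  have h3 := add_mem h1 h2
  convert! h3 using 1
  rw [Finset.sum_sub_distrib, Finset.sum_add_distrib, ordCer, edgeChain, edgeChain]
  abel

theorem exists_uBdry_eq_ordCer [Finite V] (p : Point (V := V) l) :
    ∃ S, G.uBdry l 1 S = G.ordCer l p := by
  obtain ⟨v⟩ := G.nonempty
  obtain ⟨D, -, hD⟩ := G.ordCer_sub_uCer_mem v p
  obtain ⟨S, hS⟩ := G.exists_uBdry_eq_uCer l v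
  exact ⟨D + S, by rw [map_add, hD, hS]; abel⟩

end Evaluation

end MGraph

/-! ### Lifting smooth simplices along the quotient by a discrete subgroup -/

section Lift

open Filter Topology

variable {W : Type*} [NormedAddCommGroup W] (L : AddSubgroup W) [DiscreteTopology L]

variable {L} in
/-- Two lifts of the same map to a quotient by a discrete subgroup differ by a locally constant
function. -/
theorem eventually_sub_eq_of_mk_eq {X : Type*} [TopologicalSpace X] {f f' : X → W} {t : X}
    (hf : ContinuousAt f t) (hf' : ContinuousAt f' t)
    (h : ∀ᶠ y in 𝓝 t, (QuotientAddGroup.mk (f y) : W ⧸ L) = QuotientAddGroup.mk (f' y)) :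
    ∀ᶠ y in 𝓝 t, f' y - f y = f' t - f t := by
  -- A neighbourhood of 0 meeting L only in 0: the difference of the lifts takes values in L and
  -- varies continuously, so near t its deviation from the value at t lies in U ∩ L.
  obtain ⟨U, hU, hU'⟩ : ∃ U : Set W, IsOpen U ∧ ∀ a ∈ L, a ∈ U ↔ a = 0 := by
    have h1 := (isOpen_discrete ({0} : Set L))
    obtain ⟨U, hU, h2⟩ := isOpen_induced_iff.mp h1
    refine ⟨U, hU, fun a ha => ?_⟩
    have := Set.ext_iff.mp h2 ⟨a, ha⟩
    simpa [Subtype.ext_iff] using this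
  have h0 : (0 : W) ∈ U := (hU' 0 L.zero_mem).mpr rfl
  have hc : ContinuousAt (fun y => (f' y - f y) - (f' t - f t)) t :=
    (hf'.sub hf).sub continuousAt_const
  have hn : ∀ᶠ y in 𝓝 t, (f' y - f y) - (f' t - f t) ∈ U :=
    hc (hU.mem_nhds (by simpa using h0))
  have hmem : ∀ y, (QuotientAddGroup.mk (f y) : W ⧸ L) = QuotientAddGroup.mk (f' y) →
      f' y - f y ∈ L := fun y hy => by
    rw [sub_eq_neg_add]; exact QuotientAddGroup.eq.mp hy
  filter_upwards [h, hn] with y hy hy'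
  exact sub_eq_zero.mp ((hU' _ (sub_mem (hmem y hy) (hmem t h.self_of_nhds))).mp hy')

variable {L} in
/-- Two lifts on a connected space of the same map to a quotient by a discrete subgroup differ by
a constant. -/
theorem exists_eq_add_of_mk_eq {X : Type*} [TopologicalSpace X] [PreconnectedSpace X] [Nonempty X]
    {f f' : X → W} (hf : Continuous f) (hf' : Continuous f')
    (h : ∀ y, (QuotientAddGroup.mk (f y) : W ⧸ L) = QuotientAddGroup.mk (f' y)) :
    ∃ a ∈ L, ∀ y, f' y = f y + a := by
  have hl : IsLocallyConstant (fun y => f' y - f y) :=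
    (IsLocallyConstant.iff_eventually_eq _).mpr fun t =>
      eventually_sub_eq_of_mk_eq hf.continuousAt hf'.continuousAt (Eventually.of_forall h)
  obtain ⟨t⟩ := ‹Nonempty X›
  refine ⟨f' t - f t, ?_, fun y => ?_⟩
  · rw [sub_eq_neg_add]; exact QuotientAddGroup.eq.mp (h t)
  · rw [← hl.apply_eq_of_preconnectedSpace y t]; abel

/-- Continuous maps from the standard simplex to a quotient by a discrete subgroup lift. -/
theorem exists_continuous_lift {q : ℕ} {s : stdSimplex ℝ (Fin (q + 1)) → W ⧸ L}
    (hs : Continuous s) :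
    ∃ c : stdSimplex ℝ (Fin (q + 1)) → W, Continuous c ∧
      ∀ y, QuotientAddGroup.mk (c y) = s y := by
  have cov : IsCoveringMap (QuotientAddGroup.mk : W → W ⧸ L) :=
    (L.isAddQuotientCoveringMap_of_comm DiscreteTopology.isDiscrete).isCoveringMap
  let v : stdSimplex ℝ (Fin (q + 1)) := ⟨Pi.single 0 1, single_mem_stdSimplex ℝ 0⟩
  -- The straight contraction of the simplex to its vertex v. Lifting the homotopy s ∘ r through the
  -- covering, from a constant at time 0, gives a lift of s at time 1.
  let r : unitInterval × stdSimplex ℝ (Fin (q + 1)) → stdSimplex ℝ (Fin (q + 1)) := fun z =>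
    ⟨(1 - (z.1 : ℝ)) • (v : Fin (q + 1) → ℝ) + (z.1 : ℝ) • (z.2 : Fin (q + 1) → ℝ),
      convex_stdSimplex ℝ _ v.2 z.2.2 (sub_nonneg.mpr z.1.2.2) z.1.2.1 (by ring)⟩
  have hr : Continuous r := by
    refine Continuous.subtype_mk ?_ _
    fun_prop
  obtain ⟨w, hw⟩ := QuotientAddGroup.mk_surjective (s v)
  let H : C(unitInterval × stdSimplex ℝ (Fin (q + 1)), W ⧸ L) := ⟨fun z => s (r z), hs.comp hr⟩
  have H0 : ∀ a, H (0, a) = QuotientAddGroup.mk (ContinuousMap.const _ w a) := by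
    intro a
    have : r (0, a) = v := by ext i; simp [r]; rfl
    change s (r (0, a)) = _
    rw [this, ← hw]; rfl
  refine ⟨fun y => cov.liftHomotopy H (ContinuousMap.const _ w) H0 (1, y), by fun_prop,
    fun y => ?_⟩
  have h1 : r (1, y) = y := by ext i; simp [r]; rfl
  have h2 := congr_fun (cov.liftHomotopy_lifts (H := H) (f := ContinuousMap.const _ w) H0) (1, y)
  rw [Function.comp_apply] at h2
  rw [h2]
  change s (r (1, y)) = _
  rw [h1]

variable [NormedSpace ℝ W]

/-- A map from the standard simplex to a quotient by a discrete subgroup that locally lifts to a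
smooth map has a lift that extends to a smooth map on the whole space. -/
theorem exists_smooth_lift {q : ℕ} {s : stdSimplex ℝ (Fin (q + 1)) → W ⧸ L}
    (hs : ∀ t : stdSimplex ℝ (Fin (q + 1)), ∃ f : (Fin (q + 1) → ℝ) → W,
      ∃ U : Set (Fin (q + 1) → ℝ), IsOpen U ∧ (t : Fin (q + 1) → ℝ) ∈ U ∧ ContDiffOn ℝ ∞ f U ∧
        ∀ y : stdSimplex ℝ (Fin (q + 1)), (y : Fin (q + 1) → ℝ) ∈ U →
          QuotientAddGroup.mk (f y) = s y) :
    ∃ F : (Fin (q + 1) → ℝ) → W, ContDiff ℝ ∞ F ∧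
      ∀ y : stdSimplex ℝ (Fin (q + 1)), QuotientAddGroup.mk (F y) = s y := by
  have hcont : Continuous s := by
    rw [continuous_iff_continuousAt]
    intro t
    obtain ⟨f, U, hU, ht, hf, hfs⟩ := hs t
    have h1 : ContinuousAt (fun y : stdSimplex ℝ (Fin (q + 1)) =>
        (QuotientAddGroup.mk (f y) : W ⧸ L)) t := by
      refine QuotientAddGroup.continuous_mk.continuousAt.comp ?_
      exact (hf.continuousOn.continuousAt (hU.mem_nhds ht)).comp continuous_subtype_val.continuousAt
    refine h1.congr ?_
    filter_upwards [continuous_subtype_val.continuousAt (hU.mem_nhds ht)] with y hy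
    exact hfs y hy
  obtain ⟨c, hc, hcs⟩ := exists_continuous_lift L hcont
  -- Partition of unity: the condition "equal to c(y) if y lies on the simplex" cuts out a convex
  -- set of values, a point on the simplex and everything off it. So local smooth solutions glue to
  -- a global one that agrees with c on the simplex.
  obtain ⟨F, hF⟩ := exists_contMDiffMap_forall_mem_convex_of_local (n := ⊤)
    (modelWithCornersSelf ℝ (Fin (q + 1) → ℝ)) (F := W)
    (t := fun y => {w | ∀ h : y ∈ stdSimplex ℝ (Fin (q + 1)), w = c ⟨y, h⟩})
    (fun y => by
      intro w hw w' hw' α β _ _ hαβ h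
      rw [hw h, hw' h, ← add_smul, hαβ, one_smul])
    (fun y => by
      by_cases hy : y ∈ stdSimplex ℝ (Fin (q + 1))
      · obtain ⟨f, U, hU, ht, hf, hfs⟩ := hs ⟨y, hy⟩
        -- Near y the given local lift differs from c by a constant; adding that constant makes it a
        -- local smooth extension of c.
        have h1 := eventually_sub_eq_of_mk_eq (L := L) (t := (⟨y, hy⟩ : stdSimplex ℝ (Fin (q + 1))))
          (f := fun z : stdSimplex ℝ (Fin (q + 1)) => f z) (f' := c)
          ((hf.continuousOn.continuousAt (hU.mem_nhds ht)).comp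
            continuous_subtype_val.continuousAt) hc.continuousAt
          (by
            filter_upwards [continuous_subtype_val.continuousAt (hU.mem_nhds ht)] with z hz
            rw [hfs z hz, hcs])
        rw [nhds_subtype, eventually_comap] at h1
        refine ⟨_, inter_mem h1 (hU.mem_nhds ht), fun z => f z + (c ⟨y, hy⟩ - f y), ?_, ?_⟩
        · refine ContDiffOn.contMDiffOn ?_
          exact ((hf.mono Set.inter_subset_right).add contDiffOn_const)
        · rintro z ⟨hz, -⟩ h
          have h2 : c ⟨z, h⟩ - f z = c ⟨y, hy⟩ - f y := hz ⟨z, h⟩ rfl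
          change f z + (c ⟨y, hy⟩ - f y) = _
          rw [← h2]; abel
      · refine ⟨(stdSimplex ℝ (Fin (q + 1)))ᶜ,
          (isClosed_stdSimplex ℝ _).isOpen_compl.mem_nhds hy, fun _ => 0, contMDiffOn_const, ?_⟩
        intro z hz h
        exact absurd h hz)
  exact ⟨F, F.contMDiff.contDiff, fun y => by rw [hF y y.2, hcs]; rfl⟩

end Lift

namespace MGraph

/-! ### Coordinates and lifts of smooth simplices -/

section Coordinates

variable {V E : Type*} {G : MGraph V E} {g : ℕ} (b : Module.Basis (Fin g) ℤ G.H1)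

theorem eps_apply (i : Fin g) (γ : G.H1) : G.eps b i γ = (b.repr γ i : ℝ) := rfl

theorem Coh.apply_eq_sum (u : G.Coh ℝ) (γ : G.H1) : u γ = ∑ i, (b.repr γ i : ℝ) * u (b i) := by
  conv_lhs => rw [← b.sum_repr γ]
  rw [map_sum]
  refine Finset.sum_congr rfl fun i _ => ?_
  rw [map_zsmul, zsmul_eq_mul]

/-- The coordinates `z_i(u) = u(b_i)` on `N_ℝ`. -/
def coords : G.Coh ℝ ≃ₗ[ℝ] (Fin g → ℝ) where
  toFun u i := u (b i)
  map_add' _ _ := rfl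
  map_smul' _ _ := rfl
  invFun w := ∑ i, w i • G.eps b i
  left_inv u := by
    ext γ
    rw [u.apply_eq_sum b γ, Coh.sum_apply]
    exact Finset.sum_congr rfl fun i _ => by rw [Coh.smul_apply, eps_apply, mul_comm]
  right_inv w := by
    ext j
    simp [eps_apply, Finsupp.single_apply]

@[simp] theorem coords_apply (u : G.Coh ℝ) (i : Fin g) : coords b u i = u (b i) := rfl

theorem eq_sum_eps (u : G.Coh ℝ) : u = ∑ i, u (b i) • G.eps b i :=
  ((coords b).left_inv u).symm

variable (G) in
/-- `H₁(G, ℤ)` is a direct summand of `C₁(G, ℤ)`. -/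
theorem exists_retraction [Finite V] : ∃ r : (E →₀ ℤ) →ₗ[ℤ] G.H1, ∀ γ : G.H1, r γ = γ := by
  -- The image of the boundary map is a subgroup of a free abelian group, hence free, so the
  -- boundary map splits.
  have : Module.Free ℤ (LinearMap.range G.bdry) := inferInstance
  obtain ⟨σ, hσ⟩ := G.bdry.rangeRestrict.exists_rightInverse_of_surjective
    G.bdry.range_rangeRestrict
  have hσ' : ∀ c, G.bdry (σ (G.bdry.rangeRestrict c)) = G.bdry c := fun c =>
    congrArg Subtype.val (LinearMap.congr_fun hσ (G.bdry.rangeRestrict c))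
  have hk : ∀ c, (LinearMap.id - σ ∘ₗ G.bdry.rangeRestrict : (E →₀ ℤ) →ₗ[ℤ] (E →₀ ℤ)) c ∈
      G.H1 := fun c => LinearMap.mem_ker.mpr (by
      rw [LinearMap.sub_apply, LinearMap.id_apply, LinearMap.comp_apply, map_sub, hσ', sub_self])
  refine ⟨LinearMap.codRestrict G.H1 _ hk, fun γ => ?_⟩
  have h0 : G.bdry.rangeRestrict γ = 0 := Subtype.ext (LinearMap.mem_ker.mp γ.2)
  ext1
  simp [h0]

variable [Fintype E]

/-- A basis of the cycles is linearly independent over the reals. -/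
theorem eq_zero_of_sum_mul_basis_eq_zero [Finite V] {r : Fin g → ℝ}
    (h : ∀ e, ∑ i, r i * ((b i : E →₀ ℤ) e : ℝ) = 0) : r = 0 := by
  classical
  obtain ⟨ρ, hρ⟩ := G.exists_retraction
  ext j
  -- Through the retraction, the j-th coordinate of a cycle is an integral linear combination of its
  -- edge coefficients, so a real relation between the edge coefficients of the `b i` already forces
  -- r j = 0.
  have key : ∀ c : E →₀ ℤ, b.repr (ρ c) j = ∑ e, c e * b.repr (ρ (Finsupp.single e 1)) j := by
    intro c
    conv_lhs => rw [← Finsupp.univ_sum_single c]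
    rw [map_sum, map_sum, Finsupp.finsetSum_apply]
    refine Finset.sum_congr rfl fun e _ => ?_
    rw [← mul_one (c e), ← smul_eq_mul, ← Finsupp.smul_single, map_smul, map_smul]
    simp
  calc r j = ∑ i, r i * (b.repr (ρ (b i : E →₀ ℤ)) j : ℝ) := by
        simp [hρ, Finsupp.single_apply]
    _ = ∑ e, (b.repr (ρ (Finsupp.single e 1)) j : ℝ) * ∑ i, r i * ((b i : E →₀ ℤ) e : ℝ) := by
        have h1 : ∀ i, (b.repr (ρ (b i : E →₀ ℤ)) j : ℝ) =
            ∑ e, ((b i : E →₀ ℤ) e : ℝ) * (b.repr (ρ (Finsupp.single e 1)) j : ℝ) := fun i => by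
          rw [key]; push_cast; rfl
        simp_rw [h1, Finset.mul_sum]
        rw [Finset.sum_comm]
        exact Finset.sum_congr rfl fun e _ => Finset.sum_congr rfl fun i _ => by ring
    _ = 0 := by simp [h]

variable {l : E → ℝ}

/-- The images in `N_ℝ` of a basis of the cycles are linearly independent. -/
theorem linearIndependent_coords_proj [Finite V] (hl : ∀ e, 0 < l e) :
    LinearIndependent ℝ (fun i => coords b (G.proj l (b i : E →₀ ℤ))) := by
  rw [Fintype.linearIndependent_iff]
  intro r hr
  have h1 : ∀ j, ∑ i, r i * ∑ e, ((b i : E →₀ ℤ) e : ℝ) * ((b j : E →₀ ℤ) e : ℝ) * l e = 0 := by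
    intro j
    have := congr_fun hr j
    simpa [pairing, Finset.sum_apply] using this
  -- Pair the relation ∑ r_i π(b_i) = 0 with ∑ r_j b_j: the length form of this real cycle vanishes,
  -- and positivity of the lengths kills each coefficient.
  have h2 : ∑ e, (∑ i, r i * ((b i : E →₀ ℤ) e : ℝ)) ^ 2 * l e = 0 := by
    have : ∑ j, r j * ∑ i, r i *
        ∑ e, ((b i : E →₀ ℤ) e : ℝ) * ((b j : E →₀ ℤ) e : ℝ) * l e = 0 := by
      simp [h1]
    rw [← this]
    simp_rw [sq, Finset.sum_mul, Finset.mul_sum]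
    rw [Finset.sum_comm]
    refine Finset.sum_congr rfl fun i _ => ?_
    rw [Finset.sum_comm]
    simp_rw [Finset.sum_mul]
    exact Finset.sum_congr rfl fun j _ => Finset.sum_congr rfl fun e _ => by ring
  have h3 : ∀ e, ∑ i, r i * ((b i : E →₀ ℤ) e : ℝ) = 0 := by
    intro e
    have := (Finset.sum_eq_zero_iff_of_nonneg
      (fun e _ => mul_nonneg (sq_nonneg _) (hl e).le)).mp h2 e (Finset.mem_univ e)
    exact pow_eq_zero_iff two_ne_zero |>.mp ((mul_eq_zero.mp this).resolve_right (hl e).ne')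
  exact fun i => congr_fun (eq_zero_of_sum_mul_basis_eq_zero b h3) i

/-- The lattice `Λ_C` is discrete. -/
theorem discreteTopology_lattice [Finite V] (hl : ∀ e, 0 < l e) :
    DiscreteTopology ((G.lattice l).map (coords b).toLinearMap.toAddMonoidHom) := by
  let B := basisOfLinearIndependentOfCardEqFinrank' _ (linearIndependent_coords_proj b hl)
    (by simp)
  -- In coordinates Λ_C is the ℤ-span of a real basis, for which discreteness is known.
  have hB : (G.lattice l).map (coords b).toLinearMap.toAddMonoidHom =
      (Submodule.span ℤ (Set.range B)).toAddSubgroup := by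
    have h1 : Set.range B = ((coords b).toLinearMap.toAddMonoidHom.comp
        ((G.proj l).comp G.H1.subtype.toAddMonoidHom)).toIntLinearMap '' Set.range b := by
      rw [← Set.range_comp]
      congr 1
      ext1 i
      simp [B]
    rw [h1, Submodule.span_image, b.span_eq]
    ext w
    constructor
    · rintro ⟨_, ⟨c, hc, rfl⟩, rfl⟩
      exact ⟨⟨c, hc⟩, trivial, rfl⟩
    · rintro ⟨γ, -, rfl⟩
      exact ⟨_, ⟨γ, γ.2, rfl⟩, rfl⟩
  rw [hB]
  infer_instance

variable (l) in
/-- `Jac(C)` as a quotient of the coordinate space. -/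
def jacEquiv : G.Jac l ≃+
    (Fin g → ℝ) ⧸ (G.lattice l).map (coords b).toLinearMap.toAddMonoidHom :=
  QuotientAddGroup.congr _ _ (coords b).toAddEquiv rfl

theorem mk_coords (u : G.Coh ℝ) :
    QuotientAddGroup.mk (coords b u) = jacEquiv b l (QuotientAddGroup.mk u) := rfl

/-- `F` is smooth and lifts the simplex `s`. -/
structure IsSmoothLift {q : ℕ} (s : G.SmoothSimplex l q) (F : (Fin (q + 1) → ℝ) → G.Coh ℝ) :
    Prop where
  contDiff : ∀ γ : G.H1, ContDiff ℝ ∞ (fun y => F y γ)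
  mk_eq : ∀ y : stdSimplex ℝ (Fin (q + 1)), QuotientAddGroup.mk (F y) = s.1 y

theorem IsSmoothLift.contDiff_coords {q : ℕ} {s : G.SmoothSimplex l q}
    {F : (Fin (q + 1) → ℝ) → G.Coh ℝ} (h : IsSmoothLift s F) :
    ContDiff ℝ ∞ (fun y => coords b (F y)) :=
  contDiff_pi.mpr fun i => h.contDiff (b i)

/-- The lifting takes place in the coordinate space ℝ^g, where the lattice is discrete, and is
carried back to N_ℝ. Each function u ↦ u(γ) is a fixed combination of the coordinates, so it
inherits smoothness. -/
theorem exists_isSmoothLift [Finite V] (b : Module.Basis (Fin g) ℤ G.H1)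
    (hl : ∀ e, 0 < l e) {q : ℕ} (s : G.SmoothSimplex l q) :
    ∃ F, IsSmoothLift s F := by
  have := discreteTopology_lattice b hl
  obtain ⟨F, hF, hFs⟩ := exists_smooth_lift
    ((G.lattice l).map (coords b).toLinearMap.toAddMonoidHom)
    (s := fun y => jacEquiv b l (s.1 y)) (fun t => by
      obtain ⟨f, U, hU, ht, hf, hfs⟩ := s.2 t
      refine ⟨fun y => coords b (f y), U, hU, ht, contDiffOn_pi.mpr fun i => hf (b i),
        fun y hy => ?_⟩
      rw [mk_coords, ← hfs y hy]
      rfl)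
  refine ⟨fun y => (coords b).symm (F y), fun γ => ?_, fun y => ?_⟩
  · have h1 : ∀ y, (coords b).symm (F y) γ = ∑ i, (b.repr γ i : ℝ) * F y i := fun y => by
      rw [Coh.apply_eq_sum b]
      refine Finset.sum_congr rfl fun i _ => ?_
      rw [← coords_apply b, LinearEquiv.apply_symm_apply]
    simp_rw [h1]
    exact ContDiff.sum fun i _ => contDiff_const.mul (contDiff_pi.mp hF i)
  · apply (jacEquiv b l).injective
    rw [← mk_coords, LinearEquiv.apply_symm_apply, hFs]

/-- The simplex is connected and Λ_C is discrete. Off the simplex two lifts are unrelated. -/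
theorem IsSmoothLift.exists_eq_add [Finite V] (b : Module.Basis (Fin g) ℤ G.H1)
    (hl : ∀ e, 0 < l e)
    {q : ℕ} {s : G.SmoothSimplex l q}
    {F F' : (Fin (q + 1) → ℝ) → G.Coh ℝ} (h : IsSmoothLift s F) (h' : IsSmoothLift s F') :
    ∃ a ∈ G.lattice l, ∀ y ∈ stdSimplex ℝ (Fin (q + 1)), F' y = F y + a := by
  have := discreteTopology_lattice b hl
  have : PreconnectedSpace (stdSimplex ℝ (Fin (q + 1))) :=
    Subtype.preconnectedSpace (convex_stdSimplex ℝ _).isPreconnected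
  obtain ⟨_, ⟨a, ha, rfl⟩, hFF⟩ := exists_eq_add_of_mk_eq
    (L := (G.lattice l).map (coords b).toLinearMap.toAddMonoidHom)
    (f := fun y : stdSimplex ℝ (Fin (q + 1)) => coords b (F y)) (f' := fun y => coords b (F' y))
    ((h.contDiff_coords b).continuous.comp continuous_subtype_val)
    ((h'.contDiff_coords b).continuous.comp continuous_subtype_val)
    (fun y => by rw [mk_coords, mk_coords, h.mk_eq, h'.mk_eq])
  refine ⟨a, ha, fun y hy => ?_⟩
  apply (coords b).injective
  rw [map_add]
  exact hFF ⟨y, hy⟩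

end Coordinates

end MGraph

/-! ### Stokes' theorem for the triangle -/

section Stokes

open MeasureTheory Set

/-- The standard triangle in the plane. -/
def triangle : Set (ℝ × ℝ) := {y | 0 ≤ y.1 ∧ 0 ≤ y.2 ∧ y.1 + y.2 ≤ 1}

theorem convex_triangle : Convex ℝ triangle := by
  rintro x ⟨h1, h2, h3⟩ y ⟨h1', h2', h3'⟩ a b ha hb hab
  refine ⟨?_, ?_, ?_⟩
  · exact add_nonneg (mul_nonneg ha h1) (mul_nonneg hb h1')
  · exact add_nonneg (mul_nonneg ha h2) (mul_nonneg hb h2')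
  · calc (a • x + b • y).1 + (a • x + b • y).2 = a * (x.1 + x.2) + b * (y.1 + y.2) := by
          simp; ring
      _ ≤ a * 1 + b * 1 := by gcongr
      _ = 1 := by linarith

theorem isCompact_triangle : IsCompact triangle := by
  have hclosed : IsClosed triangle :=
    (isClosed_le continuous_const continuous_fst).inter
      ((isClosed_le continuous_const continuous_snd).inter
        (isClosed_le (continuous_fst.add continuous_snd) continuous_const))
  have hbox : IsCompact (Icc (0 : ℝ) 1 ×ˢ Icc (0 : ℝ) 1) := isCompact_Icc.prod isCompact_Icc
  refine hbox.of_isClosed_subset hclosed ?_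
  rintro y ⟨h1, h2, h3⟩
  exact ⟨⟨h1, by linarith⟩, ⟨h2, by linarith⟩⟩

/-- The frontier of a convex set is null. This discards the boundary points, where the derivatives
of a chosen local lift need not be determined by the simplex. -/
theorem ae_mem_interior_triangle : ∀ᵐ y : ℝ × ℝ, y ∈ triangle → y ∈ interior triangle := by
  have h := convex_triangle.addHaar_frontier (volume : Measure (ℝ × ℝ))
  filter_upwards [measure_eq_zero_iff_ae_notMem.mp h] with y hy hyT
  by_contra hint
  exact hy ⟨subset_closure hyT, hint⟩

theorem setIntegral_triangle {f : ℝ × ℝ → ℝ} (hf : Continuous f) :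
    ∫ y in triangle, f y = ∫ s in (0 : ℝ)..1, ∫ t in (0 : ℝ)..(1 - s), f (s, t) := by
  have hm := isCompact_triangle.measurableSet
  have hi : Integrable (triangle.indicator f) :=
    (integrable_indicator_iff hm).mpr (hf.continuousOn.integrableOn_compact isCompact_triangle)
  rw [← integral_indicator hm, Measure.volume_eq_prod, integral_prod _ hi,
    intervalIntegral.integral_of_le zero_le_one, ← integral_Icc_eq_integral_Ioc,
    ← integral_indicator measurableSet_Icc]
  congr 1
  ext s
  by_cases hs : s ∈ Icc (0 : ℝ) 1
  · rw [indicator_of_mem hs, intervalIntegral.integral_of_le (by linarith [hs.2]),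
      ← integral_Icc_eq_integral_Ioc, ← integral_indicator measurableSet_Icc]
    congr 1
    ext t
    by_cases ht : t ∈ Icc (0 : ℝ) (1 - s)
    · rw [indicator_of_mem ht, indicator_of_mem]
      exact ⟨hs.1, ht.1, by linarith [ht.2]⟩
    · rw [indicator_of_notMem ht, indicator_of_notMem]
      rintro ⟨-, h2, h3⟩
      exact ht ⟨h2, by simp only at h3; linarith⟩
  · rw [indicator_of_notMem hs]
    refine integral_eq_zero_of_ae (Filter.Eventually.of_forall fun t => ?_)
    refine indicator_of_notMem ?_ _
    rintro ⟨h1, h2, h3⟩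
    exact hs ⟨h1, by simp only at h2 h3; linarith⟩

theorem setIntegral_triangle_swap {f : ℝ × ℝ → ℝ} (hf : Continuous f) :
    ∫ y in triangle, f y = ∫ t in (0 : ℝ)..1, ∫ s in (0 : ℝ)..(1 - t), f (s, t) := by
  refine Eq.trans ?_ (setIntegral_triangle (f := fun y => f y.swap) (by fun_prop))
  have h := (Measure.measurePreserving_swap (μ := (volume : Measure ℝ))
    (ν := (volume : Measure ℝ))).setIntegral_preimage_emb
    (MeasurableEquiv.prodComm.measurableEmbedding) f triangle
  rw [Measure.volume_eq_prod, ← h]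
  congr 2
  ext y
  simp only [triangle, mem_preimage, mem_ofPred_eq, Prod.fst_swap, Prod.snd_swap]
  rw [add_comm]; tauto

theorem setIntegral_triangle_fderiv_snd {Q : ℝ × ℝ → ℝ} (hQ : ContDiff ℝ 1 Q) :
    ∫ y in triangle, fderiv ℝ Q y (0, 1) = ∫ s in (0 : ℝ)..1, (Q (s, 1 - s) - Q (s, 0)) := by
  have hc : Continuous (fun y => fderiv ℝ Q y (0, 1)) :=
    (hQ.continuous_fderiv one_ne_zero).clm_apply continuous_const
  rw [setIntegral_triangle hc]
  congr 1
  ext s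
  have hd : ∀ t, HasDerivAt (fun t => Q (s, t)) (fderiv ℝ Q (s, t) (0, 1)) t := fun t =>
    ((hQ.differentiable one_ne_zero (s, t)).hasFDerivAt).comp_hasDerivAt t
      ((hasDerivAt_const t s).prodMk (hasDerivAt_id t))
  exact intervalIntegral.integral_eq_sub_of_hasDerivAt (fun t _ => hd t)
    ((hc.comp (by fun_prop : Continuous fun t => ((s, t) : ℝ × ℝ))).intervalIntegrable _ _)

theorem setIntegral_triangle_fderiv_fst {P : ℝ × ℝ → ℝ} (hP : ContDiff ℝ 1 P) :
    ∫ y in triangle, fderiv ℝ P y (1, 0) = ∫ t in (0 : ℝ)..1, (P (1 - t, t) - P (0, t)) := by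
  have hc : Continuous (fun y => fderiv ℝ P y (1, 0)) :=
    (hP.continuous_fderiv one_ne_zero).clm_apply continuous_const
  rw [setIntegral_triangle_swap hc]
  congr 1
  ext t
  have hd : ∀ s, HasDerivAt (fun s => P (s, t)) (fderiv ℝ P (s, t) (1, 0)) s := fun s =>
    ((hP.differentiable one_ne_zero (s, t)).hasFDerivAt).comp_hasDerivAt s
      ((hasDerivAt_id s).prodMk (hasDerivAt_const s t))
  exact intervalIntegral.integral_eq_sub_of_hasDerivAt (fun s _ => hd s)
    ((hc.comp (by fun_prop : Continuous fun s => ((s, t) : ℝ × ℝ))).intervalIntegrable _ _)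

/-- `∫ da ∧ db` over the triangle is the integral of `a db` over its boundary. -/
theorem setIntegral_triangle_wedge {a b : ℝ × ℝ → ℝ} (ha : ContDiff ℝ ∞ a) (hb : ContDiff ℝ ∞ b) :
    ∫ y in triangle, (fderiv ℝ a y (1, 0) * fderiv ℝ b y (0, 1) -
        fderiv ℝ a y (0, 1) * fderiv ℝ b y (1, 0)) =
      (∫ t in (0 : ℝ)..1, a (1 - t, t) * deriv (fun t => b (1 - t, t)) t) -
      (∫ t in (0 : ℝ)..1, a (0, t) * deriv (fun t => b (0, t)) t) +
      ∫ t in (0 : ℝ)..1, a (t, 0) * deriv (fun t => b (t, 0)) t := by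
  have hb' : ∀ v : ℝ × ℝ, ContDiff ℝ ∞ (fun y => fderiv ℝ b y v) := fun v =>
    (hb.fderiv_right (by simp)).clm_apply contDiff_const
  have h1 : (1 : ℕ∞ω) ≤ ∞ := by simp
  have hne : (∞ : ℕ∞ω) ≠ 0 := by simp
  have hP : ContDiff ℝ 1 (fun y => a y * fderiv ℝ b y (0, 1)) := (ha.mul (hb' _)).of_le h1
  have hQ : ContDiff ℝ 1 (fun y => a y * fderiv ℝ b y (1, 0)) := (ha.mul (hb' _)).of_le h1
  have hda : ∀ y, DifferentiableAt ℝ a y := fun y => ha.differentiable hne y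
  have hdb : ∀ y, DifferentiableAt ℝ b y := fun y => hb.differentiable hne y
  have hddb : ∀ v y, DifferentiableAt ℝ (fun y => fderiv ℝ b y v) y := fun v y =>
    (hb' v).differentiable hne y
  have hd2 : ∀ y, DifferentiableAt ℝ (fderiv ℝ b) y := fun y =>
    (hb.fderiv_right (m := ∞) (by simp)).differentiable hne y
  -- Symmetry of second derivatives, that is d(db) = 0; it makes da ∧ db = d(a db) in `key`.
  have hsymm : ∀ y, fderiv ℝ (fun y => fderiv ℝ b y (0, 1)) y (1, 0) =
      fderiv ℝ (fun y => fderiv ℝ b y (1, 0)) y (0, 1) := by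
    intro y
    have hs : IsSymmSndFDerivAt ℝ b y := hb.contDiffAt.isSymmSndFDerivAt (by
      simpa using (WithTop.coe_le_coe.2 le_top : ((2 : ℕ∞) : ℕ∞ω) ≤ ∞))
    rw [fderiv_clm_apply (hd2 y) (differentiableAt_const _),
      fderiv_clm_apply (hd2 y) (differentiableAt_const _)]
    simpa using hs (1, 0) (0, 1)
  have key : ∀ y, fderiv ℝ a y (1, 0) * fderiv ℝ b y (0, 1) -
        fderiv ℝ a y (0, 1) * fderiv ℝ b y (1, 0) =
      fderiv ℝ (fun y => a y * fderiv ℝ b y (0, 1)) y (1, 0) -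
        fderiv ℝ (fun y => a y * fderiv ℝ b y (1, 0)) y (0, 1) := by
    intro y
    rw [fderiv_fun_mul (hda y) (hddb _ y), fderiv_fun_mul (hda y) (hddb _ y)]
    simp only [add_apply, smul_apply, smul_eq_mul, hsymm]
    ring
  have hint : ∀ (F : ℝ × ℝ → ℝ), ContDiff ℝ 1 F → ∀ v : ℝ × ℝ,
      IntegrableOn (fun y => fderiv ℝ F y v) triangle := fun F hF v =>
    ((hF.continuous_fderiv one_ne_zero).clm_apply
      continuous_const).continuousOn.integrableOn_compact isCompact_triangle
  simp_rw [key]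
  rw [integral_sub (hint _ hP _) (hint _ hQ _), setIntegral_triangle_fderiv_fst hP,
    setIntegral_triangle_fderiv_snd hQ]
  have hD : ∀ (v : ℝ × ℝ) (c : ℝ → ℝ × ℝ), Continuous c →
      IntervalIntegrable (fun t => a (c t) * fderiv ℝ b (c t) v) volume 0 1 := fun v c hc =>
    ((ha.continuous.comp hc).mul ((hb' v).continuous.comp hc)).intervalIntegrable _ _
  have d0 : ∀ t, deriv (fun t => b (1 - t, t)) t =
      fderiv ℝ b (1 - t, t) (0, 1) - fderiv ℝ b (1 - t, t) (1, 0) := by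
    intro t
    have h := HasFDerivAt.comp_hasDerivAt (f := fun t => ((1 - t, t) : ℝ × ℝ)) t
      (hdb (1 - t, t)).hasFDerivAt (((hasDerivAt_id t).const_sub 1).prodMk (hasDerivAt_id t))
    refine h.deriv.trans ?_
    rw [← map_sub]; simp
  have d1 : ∀ t, deriv (fun t => b (0, t)) t = fderiv ℝ b (0, t) (0, 1) := fun t =>
    (((hdb (0, t)).hasFDerivAt).comp_hasDerivAt t
      ((hasDerivAt_const t (0 : ℝ)).prodMk (hasDerivAt_id t))).deriv
  have d2 : ∀ t, deriv (fun t => b (t, 0)) t = fderiv ℝ b (t, 0) (1, 0) := fun t =>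
    (((hdb (t, 0)).hasFDerivAt).comp_hasDerivAt t
      ((hasDerivAt_id t).prodMk (hasDerivAt_const t (0 : ℝ)))).deriv
  -- Integration over horizontal and vertical slices parametrizes the hypotenuse as (1 - t, t) and
  -- as (s, 1 - s); the substitution s = 1 - t brings both contributions together.
  have hflip := intervalIntegral.integral_comp_sub_left (a := 0) (b := 1)
    (fun t => a (t, 1 - t) * fderiv ℝ b (t, 1 - t) (1, 0)) 1
  simp only [sub_sub_cancel, sub_zero, sub_self] at hflip
  simp_rw [d0, d1, d2, mul_sub]
  rw [intervalIntegral.integral_sub (hD _ _ (by fun_prop)) (hD _ _ (by fun_prop)),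
    intervalIntegral.integral_sub (hD _ _ (by fun_prop)) (hD _ _ (by fun_prop)),
    intervalIntegral.integral_sub (hD _ _ (by fun_prop)) (hD _ _ (by fun_prop)), hflip]
  ring

end Stokes

/-! ### Expansion of wedge products in a basis -/

/-- A sum over all triples of a function vanishing on triples with repeated entries, as a sum over
the increasing triples. -/
theorem sum_triples {X : Type*} [AddCommMonoid X] {g : ℕ} (f : Fin g → Fin g → Fin g → X)
    (h₁ : ∀ i k, f i i k = 0) (h₂ : ∀ i k, f i k k = 0) (h₃ : ∀ i k, f i k i = 0) :
    ∑ i, ∑ j, ∑ k, f i j k = ∑ I : Fin g × Fin g × Fin g with I.1 < I.2.1 ∧ I.2.1 < I.2.2,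
      (f I.1 I.2.1 I.2.2 + f I.1 I.2.2 I.2.1 + f I.2.1 I.1 I.2.2 + f I.2.1 I.2.2 I.1 +
        f I.2.2 I.1 I.2.1 + f I.2.2 I.2.1 I.1) := by
  let T := Fin g × Fin g × Fin g
  -- For each permutation, the sum of the permuted values over increasing triples is the sum of f
  -- over triples of one order type. A triple with distinct entries has exactly one of the six order
  -- types; the others contribute zero.
  have h132 : ∑ I : T, (if I.1 < I.2.1 ∧ I.2.1 < I.2.2 then f I.1 I.2.2 I.2.1 else 0) =
      ∑ I : T, if I.1 < I.2.2 ∧ I.2.2 < I.2.1 then f I.1 I.2.1 I.2.2 else 0 :=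
    Fintype.sum_equiv ⟨fun I : T => (I.1, I.2.2, I.2.1), fun I => (I.1, I.2.2, I.2.1),
      fun _ => rfl, fun _ => rfl⟩ _ _ fun _ => rfl
  have h213 : ∑ I : T, (if I.1 < I.2.1 ∧ I.2.1 < I.2.2 then f I.2.1 I.1 I.2.2 else 0) =
      ∑ I : T, if I.2.1 < I.1 ∧ I.1 < I.2.2 then f I.1 I.2.1 I.2.2 else 0 :=
    Fintype.sum_equiv ⟨fun I : T => (I.2.1, I.1, I.2.2), fun I => (I.2.1, I.1, I.2.2),
      fun _ => rfl, fun _ => rfl⟩ _ _ fun _ => rfl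
  have h231 : ∑ I : T, (if I.1 < I.2.1 ∧ I.2.1 < I.2.2 then f I.2.1 I.2.2 I.1 else 0) =
      ∑ I : T, if I.2.2 < I.1 ∧ I.1 < I.2.1 then f I.1 I.2.1 I.2.2 else 0 :=
    Fintype.sum_equiv ⟨fun I : T => (I.2.1, I.2.2, I.1), fun I => (I.2.2, I.1, I.2.1),
      fun _ => rfl, fun _ => rfl⟩ _ _ fun _ => rfl
  have h312 : ∑ I : T, (if I.1 < I.2.1 ∧ I.2.1 < I.2.2 then f I.2.2 I.1 I.2.1 else 0) =
      ∑ I : T, if I.2.1 < I.2.2 ∧ I.2.2 < I.1 then f I.1 I.2.1 I.2.2 else 0 :=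
    Fintype.sum_equiv ⟨fun I : T => (I.2.2, I.1, I.2.1), fun I => (I.2.1, I.2.2, I.1),
      fun _ => rfl, fun _ => rfl⟩ _ _ fun _ => rfl
  have h321 : ∑ I : T, (if I.1 < I.2.1 ∧ I.2.1 < I.2.2 then f I.2.2 I.2.1 I.1 else 0) =
      ∑ I : T, if I.2.2 < I.2.1 ∧ I.2.1 < I.1 then f I.1 I.2.1 I.2.2 else 0 :=
    Fintype.sum_equiv ⟨fun I : T => (I.2.2, I.2.1, I.1), fun I => (I.2.2, I.2.1, I.1),
      fun _ => rfl, fun _ => rfl⟩ _ _ fun _ => rfl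
  simp only [Finset.sum_add_distrib, Finset.sum_filter, T] at *
  rw [h132, h213, h231, h312, h321]
  simp only [← Finset.sum_add_distrib, Fintype.sum_prod_type]
  refine Finset.sum_congr rfl fun i _ => Finset.sum_congr rfl fun j _ =>
    Finset.sum_congr rfl fun k _ => ?_
  rcases lt_trichotomy i j with h | rfl | h
  · rcases lt_trichotomy j k with h' | rfl | h'
    · simp [h, h', h.not_gt, h'.not_gt, (h.trans h').not_gt]
    · simp [h₂]
    · rcases lt_trichotomy i k with h'' | rfl | h''
      · simp [h, h', h.not_gt, h'.not_gt, h'', h''.not_gt]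
      · simp [h₃]
      · simp [h, h', h.not_gt, h'.not_gt, h'', h''.not_gt]
  · simp [h₁]
  · rcases lt_trichotomy j k with h' | rfl | h'
    · rcases lt_trichotomy i k with h'' | rfl | h''
      · simp [h, h', h.not_gt, h'.not_gt, h'', h''.not_gt]
      · simp [h₃]
      · simp [h, h', h.not_gt, h'.not_gt, h'', h''.not_gt]
    · simp [h₂]
    · simp [h, h', h.not_gt, h'.not_gt, (h'.trans h).not_gt]

section WedgeSum

variable {A : Type*} [CommRing A] {M : Type*} [AddCommGroup M] [Module A M]

theorem wedge_sum_left {ι : Type*} (s : Finset ι) (a : ι → M) (b c : M) :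
    wedge A (∑ i ∈ s, a i) b c = ∑ i ∈ s, wedge A (a i) b c :=
  map_sum (AddMonoidHom.mk' (fun a => wedge A a b c) fun x y => wedge_add_left x y b c) a s

theorem wedge_sum_mid {ι : Type*} (s : Finset ι) (a : M) (b : ι → M) (c : M) :
    wedge A a (∑ i ∈ s, b i) c = ∑ i ∈ s, wedge A a (b i) c :=
  map_sum (AddMonoidHom.mk' (fun b => wedge A a b c) fun x y => wedge_add_mid a x y c) b s

theorem wedge_sum_right {ι : Type*} (s : Finset ι) (a b : M) (c : ι → M) :
    wedge A a b (∑ i ∈ s, c i) = ∑ i ∈ s, wedge A a b (c i) :=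
  map_sum (AddMonoidHom.mk' (fun c => wedge A a b c) fun x y => wedge_add_right a b x y) c s

/-- The coordinates of a wedge product are the minors. -/
theorem wedge_expansion {g : ℕ} (ε : Fin g → M) (a b c : Fin g → A) :
    wedge A (∑ i, a i • ε i) (∑ i, b i • ε i) (∑ i, c i • ε i) =
      ∑ I : Fin g × Fin g × Fin g with I.1 < I.2.1 ∧ I.2.1 < I.2.2,
        (a I.1 * (b I.2.1 * c I.2.2 - b I.2.2 * c I.2.1) -
          a I.2.1 * (b I.1 * c I.2.2 - b I.2.2 * c I.1) +
          a I.2.2 * (b I.1 * c I.2.1 - b I.2.1 * c I.1)) •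
          wedge A (ε I.1) (ε I.2.1) (ε I.2.2) := by
  have h0 : wedge A (∑ i, a i • ε i) (∑ i, b i • ε i) (∑ i, c i • ε i) =
      ∑ i, ∑ j, ∑ k, (a i * (b j * c k)) • wedge A (ε i) (ε j) (ε k) := by
    rw [wedge_sum_left]
    refine Finset.sum_congr rfl fun i _ => ?_
    rw [wedge_sum_mid]
    refine Finset.sum_congr rfl fun j _ => ?_
    rw [wedge_sum_right]
    refine Finset.sum_congr rfl fun k _ => ?_
    rw [wedge_smul_left, wedge_smul_mid, wedge_smul_right, smul_smul, smul_smul, mul_assoc]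
  have h3 : ∀ i k, wedge A (ε i) (ε k) (ε i) = 0 := fun i k => by
    rw [wedge_swap_right, wedge_self_left, neg_zero]
  rw [h0, sum_triples _ (by simp) (by simp) (by simp [h3])]
  refine Finset.sum_congr rfl fun I _ => ?_
  obtain ⟨i, j, k⟩ := I
  dsimp only
  have e132 : wedge A (ε i) (ε k) (ε j) = (-1 : A) • wedge A (ε i) (ε j) (ε k) := by
    rw [wedge_swap_right]; exact (neg_one_smul A (wedge A (ε i) (ε j) (ε k))).symm
  have e213 : wedge A (ε j) (ε i) (ε k) = (-1 : A) • wedge A (ε i) (ε j) (ε k) := by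
    rw [wedge_swap_left]; exact (neg_one_smul A (wedge A (ε i) (ε j) (ε k))).symm
  have e231 : wedge A (ε j) (ε k) (ε i) = wedge A (ε i) (ε j) (ε k) := by
    rw [wedge_swap_right, wedge_swap_left, neg_neg]
  have e312 : wedge A (ε k) (ε i) (ε j) = wedge A (ε i) (ε j) (ε k) := by
    rw [wedge_swap_left, wedge_swap_right, neg_neg]
  have e321 : wedge A (ε k) (ε j) (ε i) = (-1 : A) • wedge A (ε i) (ε j) (ε k) := by
    rw [wedge_swap_left, e231]; exact (neg_one_smul A (wedge A (ε i) (ε j) (ε k))).symm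
  rw [e132, e213, e231, e312, e321]
  module

end WedgeSum

/-! ### Contraction of N with a 2-form. -/

namespace MGraph

variable {V E : Type*} {G : MGraph V E} {g : ℕ} (b : Module.Basis (Fin g) ℤ G.H1)

/-- `n ↦ 2 ∑_{i<j<k} (n_i w_jk - n_j w_ik + n_k w_ij) ε_i ∧ ε_j ∧ ε_k`, for the `2`-form with
coefficients `w`. -/
def contractForm (w : G.H1 → G.H1 → ℝ) : G.N →ₗ[ℤ] ⋀[ℝ]^3 (G.Coh ℝ) :=
  AddMonoidHom.toIntLinearMap
    { toFun := fun n =>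
        ∑ I : Fin g × Fin g × Fin g with I.1 < I.2.1 ∧ I.2.1 < I.2.2,
          (2 * ((n (b I.1) : ℝ) * w (b I.2.1) (b I.2.2)
            - (n (b I.2.1) : ℝ) * w (b I.1) (b I.2.2)
            + (n (b I.2.2) : ℝ) * w (b I.1) (b I.2.1))) •
          wedge ℝ (G.eps b I.1) (G.eps b I.2.1) (G.eps b I.2.2)
      map_zero' := by simp
      map_add' := fun n n' => by
        rw [← Finset.sum_add_distrib]
        refine Finset.sum_congr rfl fun I _ => ?_
        rw [← add_smul]
        congr 1
        simp only [N.add_apply, Int.cast_add]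
        ring }

theorem contractForm_apply (w : G.H1 → G.H1 → ℝ) (n : G.N) : contractForm b w n =
    ∑ I : Fin g × Fin g × Fin g with I.1 < I.2.1 ∧ I.2.1 < I.2.2,
      (2 * ((n (b I.1) : ℝ) * w (b I.2.1) (b I.2.2)
        - (n (b I.2.1) : ℝ) * w (b I.1) (b I.2.2)
        + (n (b I.2.2) : ℝ) * w (b I.1) (b I.2.1))) •
      wedge ℝ (G.eps b I.1) (G.eps b I.2.1) (G.eps b I.2.2) := rfl

theorem contractForm_add (w w' : G.H1 → G.H1 → ℝ) (n : G.N) :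
    contractForm b (w + w') n = contractForm b w n + contractForm b w' n := by
  simp only [contractForm_apply, ← Finset.sum_add_distrib]
  refine Finset.sum_congr rfl fun I _ => ?_
  rw [← add_smul]
  congr 1
  simp only [Pi.add_apply]
  ring

theorem contractForm_zero (n : G.N) : contractForm b 0 n = 0 := by
  simp [contractForm_apply]

theorem contractForm_neg (w : G.H1 → G.H1 → ℝ) (n : G.N) :
    contractForm b (-w) n = -contractForm b w n := by
  rw [eq_neg_iff_add_eq_zero, ← contractForm_add, neg_add_cancel, contractForm_zero]

/-- The form `dz ∧ dz` on an affine triangle with given edges. -/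
theorem contractForm_affine (u u' : G.Coh ℝ) (n : G.N) :
    contractForm b (fun γ γ' => (u γ * u' γ' - u' γ * u γ') / 2) n =
      wedge ℝ (G.toCoh ℝ n) u u' := by
  -- The coefficients of the wedge product are minors; the factor 2 in Θ_C cancels the area 1/2 of
  -- the standard triangle.
  rw [eq_sum_eps b (G.toCoh ℝ n), eq_sum_eps b u, eq_sum_eps b u', wedge_expansion,
    contractForm_apply, ← eq_sum_eps, ← eq_sum_eps]
  refine Finset.sum_congr rfl fun I _ => ?_
  congr 1
  simp only [toCoh_apply]
  ring

end MGraph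

namespace MGraph

open MeasureTheory Set Filter Topology

variable {V E : Type*} {G : MGraph V E}

/-! ### Paths and triangles -/

/-- `∫ z dz'` along a path, minus its value for the straight path with the same endpoints. -/
def pathDefect (φ : ℝ → G.Coh ℝ) (γ γ' : G.H1) : ℝ :=
  (∫ t in (0 : ℝ)..1, φ t γ * deriv (fun t => φ t γ') t) -
    (φ 0 γ + φ 1 γ) / 2 * (φ 1 γ' - φ 0 γ')

/-- Translation by a adds a(γ) (φ₁(γ') - φ₀(γ')) to the path integral and to its chord value alike.
So the defect is independent of the lift and defines a cochain on the Jacobian. -/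
theorem pathDefect_translate {φ ψ : ℝ → G.Coh ℝ} (hφ : ∀ γ, ContDiff ℝ ∞ (fun t => φ t γ))
    {a : G.Coh ℝ} (h : ∀ t ∈ Icc (0 : ℝ) 1, ψ t = φ t + a) : pathDefect ψ = pathDefect φ := by
  ext γ γ'
  have hd : ∀ γ t, HasDerivAt (fun t => φ t γ) (deriv (fun t => φ t γ) t) t := fun γ t =>
    ((hφ γ).differentiable (by simp) t).hasDerivAt
  have hc : ∀ γ, Continuous (deriv (fun t => φ t γ)) := fun γ =>
    (hφ γ).continuous_deriv (by simp)
  have h1 : ∫ t in (0 : ℝ)..1, ψ t γ * deriv (fun t => ψ t γ') t =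
      ∫ t in (0 : ℝ)..1, (φ t γ * deriv (fun t => φ t γ') t +
        a γ * deriv (fun t => φ t γ') t) := by
    -- The paths are compared only on [0, 1], so their derivatives can be compared only at interior
    -- points; the endpoints are null.
    rw [intervalIntegral.integral_of_le zero_le_one, intervalIntegral.integral_of_le zero_le_one,
      integral_Ioc_eq_integral_Ioo, integral_Ioc_eq_integral_Ioo]
    refine setIntegral_congr_fun measurableSet_Ioo fun t ht => ?_
    have h2 : (fun t => ψ t γ') =ᶠ[𝓝 t] fun t => φ t γ' + a γ' := by
      filter_upwards [Ioo_mem_nhds ht.1 ht.2] with t' ht'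
      rw [h t' (Ioo_subset_Icc_self ht'), Coh.add_apply]
    simp only [h2.deriv_eq, deriv_add_const, h t (Ioo_subset_Icc_self ht), Coh.add_apply, add_mul]
  have h3 : ∫ t in (0 : ℝ)..1, deriv (fun t => φ t γ') t = φ 1 γ' - φ 0 γ' :=
    intervalIntegral.integral_eq_sub_of_hasDerivAt (fun t _ => hd γ' t)
      ((hc γ').intervalIntegrable _ _)
  have h4 : IntervalIntegrable (fun t => φ t γ * deriv (fun t => φ t γ') t) volume 0 1 :=
    ((hφ γ).continuous.mul (hc γ')).intervalIntegrable _ _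
  have h5 : IntervalIntegrable (fun t => a γ * deriv (fun t => φ t γ') t) volume 0 1 :=
    (continuous_const.mul (hc γ')).intervalIntegrable _ _
  rw [pathDefect, h1, intervalIntegral.integral_add h4 h5, intervalIntegral.integral_const_mul,
    h3, h 0 (by simp), h 1 (by simp), pathDefect]
  simp only [Coh.add_apply]
  ring

theorem contDiff_edgePoint : ContDiff ℝ ∞ (fun t : ℝ => (![1 - t, t] : Fin 2 → ℝ)) := by
  refine contDiff_pi.mpr fun i => ?_
  fin_cases i
  · exact contDiff_const.sub contDiff_id
  · exact contDiff_id

theorem edgePoint_mem {t : ℝ} (ht : t ∈ Icc (0 : ℝ) 1) : ![1 - t, t] ∈ stdSimplex ℝ (Fin 2) := by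
  refine ⟨fun i => ?_, by simp⟩
  fin_cases i
  · exact sub_nonneg.mpr ht.2
  · exact ht.1

/-- The point of the standard simplex with coordinates `y`. -/
def simplexPoint (y : ℝ × ℝ) : Fin 3 → ℝ := ![1 - y.1 - y.2, y.1, y.2]

theorem contDiff_simplexPoint : ContDiff ℝ ∞ simplexPoint := by
  refine contDiff_pi.mpr fun i => ?_
  fin_cases i
  · exact (contDiff_const.sub contDiff_fst).sub contDiff_snd
  · exact contDiff_fst
  · exact contDiff_snd

theorem simplexPoint_mem {y : ℝ × ℝ} (hy : y ∈ triangle) :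
    simplexPoint y ∈ stdSimplex ℝ (Fin 3) := by
  obtain ⟨h1, h2, h3⟩ := hy
  refine ⟨fun i => ?_, by simp [simplexPoint, Fin.sum_univ_three]; ring⟩
  fin_cases i
  · change 0 ≤ 1 - y.1 - y.2
    linarith
  · exact h1
  · exact h2

/-- The coordinate directions of the plane are the directions e_k - e_0 used in `partialD`. -/
theorem simplexPoint_add_fst (y : ℝ × ℝ) (τ : ℝ) : simplexPoint (y + τ • (1, 0)) =
    simplexPoint y + τ • (Pi.single 1 1 - Pi.single 0 1) := by
  ext i; fin_cases i <;> simp [simplexPoint]; ring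

theorem simplexPoint_add_snd (y : ℝ × ℝ) (τ : ℝ) : simplexPoint (y + τ • (0, 1)) =
    simplexPoint y + τ • (Pi.single 2 1 - Pi.single 0 1) := by
  ext i; fin_cases i <;> simp [simplexPoint]; ring

theorem linearMap_succAbove_single {q : ℕ} (i : Fin (q + 2)) (j : Fin (q + 1)) :
    FunOnFinite.linearMap ℝ ℝ i.succAbove (Pi.single j (1 : ℝ)) = Pi.single (i.succAbove j) 1 :=
  FunOnFinite.linearMap_piSingle ℝ ℝ _ _ _

theorem linearMap_edgePoint (i : Fin 3) (t : ℝ) :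
    FunOnFinite.linearMap ℝ ℝ i.succAbove ![1 - t, t] =
      (1 - t) • Pi.single (i.succAbove 0) 1 + t • Pi.single (i.succAbove 1) 1 := by
  have h : (![1 - t, t] : Fin 2 → ℝ) = (1 - t) • Pi.single 0 1 + t • Pi.single 1 1 := by
    ext j; fin_cases j <;> simp
  rw [h, map_add, map_smul, map_smul, linearMap_succAbove_single, linearMap_succAbove_single]

/-- With the two analogues below, this matches the faces of a 2-simplex with the three boundary
paths in `setIntegral_triangle_wedge`. -/
theorem linearMap_edgePoint_zero (t : ℝ) :
    FunOnFinite.linearMap ℝ ℝ (0 : Fin 3).succAbove ![1 - t, t] = simplexPoint (1 - t, t) := by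
  rw [linearMap_edgePoint, show (0 : Fin 3).succAbove 0 = 1 from rfl,
    show (0 : Fin 3).succAbove 1 = 2 from rfl]
  ext i; fin_cases i <;> simp [simplexPoint]

theorem linearMap_edgePoint_one (t : ℝ) :
    FunOnFinite.linearMap ℝ ℝ (1 : Fin 3).succAbove ![1 - t, t] = simplexPoint (0, t) := by
  rw [linearMap_edgePoint, show (1 : Fin 3).succAbove 0 = 0 from rfl,
    show (1 : Fin 3).succAbove 1 = 2 from rfl]
  ext i; fin_cases i <;> simp [simplexPoint]

theorem linearMap_edgePoint_two (t : ℝ) :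
    FunOnFinite.linearMap ℝ ℝ (2 : Fin 3).succAbove ![1 - t, t] = simplexPoint (t, 0) := by
  rw [linearMap_edgePoint, show (2 : Fin 3).succAbove 0 = 0 from rfl,
    show (2 : Fin 3).succAbove 1 = 1 from rfl]
  ext i; fin_cases i <;> simp [simplexPoint]

variable [Fintype E] {l : E → ℝ}

/-! ### Straightening of smooth simplices -/

theorem IsSmoothLift.face {q : ℕ} {s : G.SmoothSimplex l (q + 1)}
    {F : (Fin (q + 2) → ℝ) → G.Coh ℝ} (h : IsSmoothLift s F) (i : Fin (q + 2)) :
    IsSmoothLift (G.smFace l i s) (fun y => F (FunOnFinite.linearMap ℝ ℝ i.succAbove y)) where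
  contDiff γ := (h.contDiff γ).comp
    (LinearMap.toContinuousLinearMap (FunOnFinite.linearMap ℝ ℝ i.succAbove)).contDiff
  mk_eq y := h.mk_eq (stdSimplex.map i.succAbove y)

theorem isSmoothLift_affine {q : ℕ} (u : Fin (q + 1) → G.Coh ℝ) :
    IsSmoothLift (G.affine l u) (fun y => ∑ i, y i • u i) where
  contDiff γ := by
    simp only [Coh.sum_apply, Coh.smul_apply]
    fun_prop
  mk_eq _ := rfl

theorem linearMap_succAbove_sum_smul {q : ℕ} {M : Type*} [AddCommGroup M] [Module ℝ M]
    (i : Fin (q + 2)) (t : Fin (q + 1) → ℝ) (u : Fin (q + 2) → M) :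
    ∑ k, FunOnFinite.linearMap ℝ ℝ i.succAbove t k • u k = ∑ j, t j • u (i.succAbove j) := by
  classical
  have h : t = ∑ j, t j • Pi.single j (1 : ℝ) := by
    ext k; simp [Finset.sum_apply, Pi.single_apply]
  conv_lhs => rw [h]
  simp only [map_sum, map_smul, linearMap_succAbove_single, Finset.sum_apply, Pi.smul_apply,
    Finset.sum_smul]
  rw [Finset.sum_comm]
  refine Finset.sum_congr rfl fun j _ => ?_
  rw [Finset.sum_eq_single (i.succAbove j)]
  · simp
  · intro k _ hk
    simp [hk]
  · simp

/-- The affine simplex of `Jac(C)` attached to an ordered simplex. -/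
def affineOrd {q : ℕ} : OrdSimplex (G.lattice l) q → G.SmoothSimplex l q :=
  Quotient.lift (G.affine l) (by
    rintro u u' ⟨a, ha, h⟩
    refine Subtype.ext (funext fun t => ?_)
    have h1 : ∑ i, t i • u' i = ∑ i, t i • u i + a := by
      simp only [h, smul_add, Finset.sum_add_distrib, ← Finset.sum_smul, stdSimplex.sum_eq_one,
        one_smul]
    change (QuotientAddGroup.mk (∑ i, t i • u i) : G.Jac l) =
      QuotientAddGroup.mk (∑ i, t i • u' i)
    rw [h1]
    exact (QuotientAddGroup.mk_add_of_mem _ ha).symm)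

theorem smFace_affineOrd {q : ℕ} (i : Fin (q + 2)) (s : OrdSimplex (G.lattice l) (q + 1)) :
    G.smFace l i (affineOrd s) = affineOrd (ordFace (G.lattice l) i s) := by
  induction s using Quotient.inductionOn with
  | h u =>
    refine Subtype.ext (funext fun t => ?_)
    exact congrArg (QuotientAddGroup.mk' (G.lattice l)) (linearMap_succAbove_sum_smul i t u)

theorem sBdry_pushChain_affineOrd (c : G.UChain l 2) :
    G.sBdry l 1 (pushChain G.N affineOrd c) = pushChain G.N affineOrd (G.uBdry l 1 c) :=
  bdryChain_pushChain smFace_affineOrd c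

theorem sCer_eq_pushChain (p : Point (V := V) l) :
    G.sCer l p = pushChain G.N affineOrd (G.ordCer l p) := by
  rw [sCer, ordCer, map_sum]
  refine Finset.sum_congr rfl fun e _ => ?_
  rw [map_list_sum, List.map_map]
  rfl

theorem exists_sBdry_eq_sCer [Finite V] (p : Point (V := V) l) :
    ∃ S, G.sBdry l 1 S = G.sCer l p := by
  obtain ⟨S, hS⟩ := G.exists_uBdry_eq_ordCer p
  exact ⟨pushChain G.N affineOrd S, by rw [sBdry_pushChain_affineOrd, hS, sCer_eq_pushChain]⟩

theorem sTheta_eq_evalChain {g : ℕ} (b : Module.Basis (Fin g) ℤ G.H1) :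
    G.sTheta l b = evalChain (G.sThetaFun l b) := rfl

theorem sBdry_eq_bdryChain (q : ℕ) : G.sBdry l q = bdryChain G.N (G.smFace l) := rfl

theorem sThetaFun_eq_contractForm {g : ℕ} (b : Module.Basis (Fin g) ℤ G.H1)
    (s : G.SmoothSimplex l 2) :
    G.sThetaFun l b s = contractForm b (G.integral2 l s) := rfl

variable {g : ℕ} (b : Module.Basis (Fin g) ℤ G.H1) (hl : ∀ e, 0 < l e) [Finite V]

/-- A lift of a smooth simplex to `N_ℝ`. -/
def smoothLift {q : ℕ} (s : G.SmoothSimplex l q) : (Fin (q + 1) → ℝ) → G.Coh ℝ :=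
  (exists_isSmoothLift b hl s).choose

theorem isSmoothLift_smoothLift {q : ℕ} (s : G.SmoothSimplex l q) :
    IsSmoothLift s (smoothLift b hl s) :=
  (exists_isSmoothLift b hl s).choose_spec

/-- The ordered simplex formed by the vertices of a lift of a smooth simplex. -/
def straighten {q : ℕ} (s : G.SmoothSimplex l q) : OrdSimplex (G.lattice l) q :=
  ordMk _ fun i => smoothLift b hl s (Pi.single i 1)

/-- Any two lifts differ on the simplex by one element of Λ_C, which moves all vertices
simultaneously. -/
theorem IsSmoothLift.straighten_eq {q : ℕ} {s : G.SmoothSimplex l q}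
    {F : (Fin (q + 1) → ℝ) → G.Coh ℝ} (h : IsSmoothLift s F) :
    straighten b hl s = ordMk _ fun i => F (Pi.single i 1) := by
  obtain ⟨a, ha, h'⟩ := (isSmoothLift_smoothLift b hl s).exists_eq_add b hl h
  exact ordMk_eq_ordMk ha fun i => h' _ (single_mem_stdSimplex ℝ i)

/-- The restriction of the chosen lift to a face need not be the chosen lift of the face;
independence of the lift makes straightening a chain map all the same. -/
theorem ordFace_straighten {q : ℕ} (i : Fin (q + 2)) (s : G.SmoothSimplex l (q + 1)) :
    ordFace _ i (straighten b hl s) = straighten b hl (G.smFace l i s) := by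
  rw [((isSmoothLift_smoothLift b hl s).face i).straighten_eq b hl]
  simp only [linearMap_succAbove_single]
  rfl

theorem straighten_affineOrd {q : ℕ} (s : OrdSimplex (G.lattice l) q) :
    straighten b hl (affineOrd s) = s := by
  induction s using Quotient.inductionOn with
  | h u =>
    change straighten b hl (G.affine l u) = ordMk _ u
    rw [(isSmoothLift_affine u).straighten_eq b hl]
    congr 1
    ext1 i
    simp [Pi.single_apply, ite_smul]

/-! ### The area of a smooth triangle and of its straightening -/

/-- `pathDefect` of a lift of a smooth edge. -/
def edgeDefect (s : G.SmoothSimplex l 1) : G.H1 → G.H1 → ℝ :=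
  pathDefect fun t => smoothLift b hl s ![1 - t, t]

theorem IsSmoothLift.edgeDefect_eq {s : G.SmoothSimplex l 1} {F : (Fin 2 → ℝ) → G.Coh ℝ}
    (h : IsSmoothLift s F) : edgeDefect b hl s = pathDefect fun t => F ![1 - t, t] := by
  obtain ⟨a, -, h'⟩ := h.exists_eq_add b hl (isSmoothLift_smoothLift b hl s)
  exact pathDefect_translate (fun γ => (h.contDiff γ).comp contDiff_edgePoint)
    fun t ht => h' _ (edgePoint_mem ht)

/-- Along a chord z is affine and dz' is constant, so the integral is its trapezoidal value. -/
theorem edgeDefect_affine (u : Fin 2 → G.Coh ℝ) : edgeDefect b hl (G.affine l u) = 0 := by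
  rw [(isSmoothLift_affine u).edgeDefect_eq b hl]
  ext γ γ'
  have hd : ∀ t : ℝ, deriv (fun t : ℝ => (1 - t) * u 0 γ' + t * u 1 γ') t = u 1 γ' - u 0 γ' := by
    intro t
    have h : HasDerivAt (fun t : ℝ => (1 - t) * u 0 γ' + t * u 1 γ')
        (-1 * u 0 γ' + 1 * u 1 γ') t :=
      (((hasDerivAt_id t).const_sub 1).mul_const _).add ((hasDerivAt_id t).mul_const _)
    rw [h.deriv]; ring
  have hi : ∫ t in (0 : ℝ)..1, ((1 - t) * u 0 γ + t * u 1 γ) = (u 0 γ + u 1 γ) / 2 := by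
    rw [intervalIntegral.integral_add (Continuous.intervalIntegrable (by fun_prop) _ _)
      (Continuous.intervalIntegrable (by fun_prop) _ _), intervalIntegral.integral_mul_const,
      intervalIntegral.integral_mul_const, intervalIntegral.integral_sub
      (Continuous.intervalIntegrable (by fun_prop) _ _)
      (Continuous.intervalIntegrable (by fun_prop) _ _)]
    simp only [intervalIntegral.integral_const, integral_id]
    norm_num
    ring
  simp [pathDefect, Fin.sum_univ_two, hd, intervalIntegral.integral_mul_const, hi]

/-- At interior points the partial derivatives of a smooth simplex are those of any lift. -/
theorem IsSmoothLift.partialD_eq (b : Module.Basis (Fin g) ℤ G.H1) (hl : ∀ e, 0 < l e)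
    {s : G.SmoothSimplex l 2} {F : (Fin 3 → ℝ) → G.Coh ℝ} (h : IsSmoothLift s F) (γ : G.H1)
    {k : Fin 3} {y d : ℝ × ℝ} (hy : y ∈ interior triangle)
    (hk : ∀ τ : ℝ, simplexPoint (y + τ • d) =
      simplexPoint y + τ • (Pi.single k 1 - Pi.single 0 1)) :
    G.partialD l s γ k (simplexPoint y) = fderiv ℝ (fun y => F (simplexPoint y) γ) y d := by
  have := discreteTopology_lattice b hl
  obtain ⟨U, hU, htU, hf, hfs⟩ : G.IsLocalLift l s.1 (simplexPoint y)
      (G.localLift l s (simplexPoint y)) :=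
    Classical.epsilon_spec (s.2 ⟨simplexPoint y, simplexPoint_mem (interior_subset hy)⟩)
  rw [partialD]
  set f := G.localLift l s (simplexPoint y)
  -- The two lifts agree modulo Λ_C only on the simplex, so they are compared along a line inside
  -- it. Near τ = 0 their difference on this line is constant, hence the derivatives coincide.
  have h1 : HasDerivAt (fun τ : ℝ => f (simplexPoint y + τ • (Pi.single k 1 - Pi.single 0 1)) γ)
      (fderiv ℝ (fun y => f y γ) (simplexPoint y) (Pi.single k 1 - Pi.single 0 1)) 0 :=
    ((((hf γ).contDiffAt (hU.mem_nhds htU)).differentiableAt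
      (by simp)).hasFDerivAt.hasLineDerivAt _)
  have h2 : HasDerivAt (fun τ : ℝ => F (simplexPoint (y + τ • d)) γ)
      (fderiv ℝ (fun y => F (simplexPoint y) γ) y d) 0 :=
    ((((h.contDiff γ).comp contDiff_simplexPoint).differentiable
      (by simp) y).hasFDerivAt.hasLineDerivAt d)
  simp only [← hk] at h1
  have hline : Continuous (fun τ : ℝ => y + τ • d) := by fun_prop
  have hline' : Continuous (fun τ : ℝ => simplexPoint (y + τ • d)) :=
    contDiff_simplexPoint.continuous.comp hline
  have hT : ∀ᶠ τ in 𝓝 (0 : ℝ), y + τ • d ∈ triangle :=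
    hline.continuousAt (mem_interior_iff_mem_nhds.mp (by simpa using hy))
  have hT' : ∀ᶠ τ in 𝓝 (0 : ℝ), simplexPoint (y + τ • d) ∈ U :=
    hline'.continuousAt (hU.mem_nhds (by simpa using htU))
  have hev := eventually_sub_eq_of_mk_eq
    (L := (G.lattice l).map (coords b).toLinearMap.toAddMonoidHom) (t := (0 : ℝ))
    (f := fun τ => coords b (F (simplexPoint (y + τ • d))))
    (f' := fun τ => coords b (f (simplexPoint (y + τ • d))))
    ((h.contDiff_coords b).continuous.comp hline').continuousAt
    (continuousAt_pi.mpr fun i => by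
      have hc : ContinuousAt (fun y => f y (b i)) (simplexPoint (y + (0 : ℝ) • d)) :=
        (hf (b i)).continuousOn.continuousAt (hU.mem_nhds (by simpa using htU))
      exact hc.comp (f := fun τ : ℝ => simplexPoint (y + τ • d)) hline'.continuousAt)
    (by
      filter_upwards [hT, hT'] with τ h3 h4
      have h5 := h.mk_eq ⟨_, simplexPoint_mem h3⟩
      have h6 := hfs ⟨_, simplexPoint_mem h3⟩ h4
      rw [mk_coords, mk_coords]
      exact congrArg _ (h5.trans h6.symm))
  refine h1.unique (HasDerivAt.congr_of_eventuallyEq (h2.add_const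
    ((f (simplexPoint (y + (0 : ℝ) • d)) - F (simplexPoint (y + (0 : ℝ) • d))) γ)) ?_)
  filter_upwards [hev] with τ hτ
  rw [← map_sub, ← map_sub] at hτ
  rw [← (coords b).injective hτ, Coh.sub_apply, add_sub_cancel]

/-- The integral of `dz ∧ dz'` over a smooth triangle is that over its straightening, up to the
defects of the edges. -/
theorem IsSmoothLift.integral2_eq {s : G.SmoothSimplex l 2} {F : (Fin 3 → ℝ) → G.Coh ℝ}
    (h : IsSmoothLift s F) : G.integral2 l s =
      (fun γ γ' => ((F (Pi.single 1 1) - F (Pi.single 0 1)) γ *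
          (F (Pi.single 2 1) - F (Pi.single 0 1)) γ' -
        (F (Pi.single 2 1) - F (Pi.single 0 1)) γ *
          (F (Pi.single 1 1) - F (Pi.single 0 1)) γ') / 2) +
      (edgeDefect b hl (G.smFace l 0 s) + -edgeDefect b hl (G.smFace l 1 s) +
        edgeDefect b hl (G.smFace l 2 s)) := by
  ext γ γ'
  have e0 : Pi.single (0 : Fin 3) (1 : ℝ) = simplexPoint (0, 0) := by
    ext i; fin_cases i <;> simp [simplexPoint]
  have e1 : Pi.single (1 : Fin 3) (1 : ℝ) = simplexPoint (1, 0) := by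
    ext i; fin_cases i <;> simp [simplexPoint]
  have e2 : Pi.single (2 : Fin 3) (1 : ℝ) = simplexPoint (0, 1) := by
    ext i; fin_cases i <;> simp [simplexPoint]
  have hS : G.integral2 l s γ γ' = ∫ y in triangle,
      (fderiv ℝ (fun y => F (simplexPoint y) γ) y (1, 0) *
        fderiv ℝ (fun y => F (simplexPoint y) γ') y (0, 1) -
      fderiv ℝ (fun y => F (simplexPoint y) γ) y (0, 1) *
        fderiv ℝ (fun y => F (simplexPoint y) γ') y (1, 0)) := by
    refine setIntegral_congr_ae isCompact_triangle.measurableSet ?_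
    filter_upwards [ae_mem_interior_triangle] with y hy hyT
    have h1 := fun γ => h.partialD_eq b hl γ (hy hyT) (simplexPoint_add_fst y)
    have h2 := fun γ => h.partialD_eq b hl γ (hy hyT) (simplexPoint_add_snd y)
    rw [← h1 γ, ← h1 γ', ← h2 γ, ← h2 γ']
    rfl
  have hF : ∀ γ, ContDiff ℝ ∞ (fun y => F (simplexPoint y) γ) := fun γ =>
    (h.contDiff γ).comp contDiff_simplexPoint
  rw [hS, setIntegral_triangle_wedge (hF γ) (hF γ')]
  have f0 : edgeDefect b hl (G.smFace l 0 s) = pathDefect fun t => F (simplexPoint (1 - t, t)) :=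
    ((h.face 0).edgeDefect_eq b hl).trans
      (congrArg _ (funext fun t => congrArg F (linearMap_edgePoint_zero t)))
  have f1 : edgeDefect b hl (G.smFace l 1 s) = pathDefect fun t => F (simplexPoint (0, t)) :=
    ((h.face 1).edgeDefect_eq b hl).trans
      (congrArg _ (funext fun t => congrArg F (linearMap_edgePoint_one t)))
  have f2 : edgeDefect b hl (G.smFace l 2 s) = pathDefect fun t => F (simplexPoint (t, 0)) :=
    ((h.face 2).edgeDefect_eq b hl).trans
      (congrArg _ (funext fun t => congrArg F (linearMap_edgePoint_two t)))
  -- After Stokes each boundary integral is a defect plus a chord value; the alternating sum of the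
  -- chord values is the shoelace formula for half the minor.
  simp only [Pi.add_apply, Pi.neg_apply, f0, f1, f2, pathDefect, e0, e1, e2, Coh.sub_apply,
    sub_zero, sub_self]
  ring

/-! ### Periods of smooth chains -/

/-- Integration over a smooth chain and over its straightening differ by a functional of the
boundary. -/
theorem sTheta_eq_add (c : G.SChain l 2) :
    G.sTheta l b c = G.uTheta l (pushChain G.N (straighten b hl) c) +
      evalChain (fun s => contractForm b (edgeDefect b hl s)) (G.sBdry l 1 c) := by
  rw [sTheta_eq_evalChain, uTheta_eq_evalChain, evalChain_pushChain, sBdry_eq_bdryChain]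
  refine evalChain_add_coboundary _ (fun s n => ?_) c
  have h := isSmoothLift_smoothLift b hl s
  rw [sThetaFun_eq_contractForm, h.integral2_eq b hl, contractForm_add, contractForm_affine,
    h.straighten_eq b hl, ordArea_ordMk, contractForm_add, contractForm_add, contractForm_neg,
    Fin.sum_univ_three]
  simp

theorem uBdry_pushChain_straighten (c : G.SChain l 2) :
    G.uBdry l 1 (pushChain G.N (straighten b hl) c) =
      pushChain G.N (straighten b hl) (G.sBdry l 1 c) :=
  bdryChain_pushChain (ordFace_straighten b hl) c

theorem pushChain_straighten_affineOrd {q : ℕ} (c : G.UChain l q) :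
    pushChain G.N (straighten b hl) (pushChain G.N affineOrd c) = c := by
  rw [pushChain_pushChain, pushChain_eq_self (straighten_affineOrd b hl)]

/-- Straightening and the affine embedding are chain maps, the first a left inverse of the second,
and on cycles the edge defects do not contribute. -/
theorem sPeriods_eq_uPeriods (hl : ∀ e, 0 < l e) : G.sPeriods l b = G.uPeriods l := by
  apply le_antisymm
  · rintro _ ⟨c, hc, rfl⟩
    rw [SetLike.mem_coe, AddMonoidHom.mem_ker] at hc
    refine ⟨pushChain G.N (straighten b hl) c, ?_, ?_⟩
    · rw [SetLike.mem_coe, AddMonoidHom.mem_ker, uBdry_pushChain_straighten, hc, map_zero]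
    · rw [sTheta_eq_add b hl, hc, map_zero, add_zero]
  · rintro _ ⟨c, hc, rfl⟩
    rw [SetLike.mem_coe, AddMonoidHom.mem_ker] at hc
    have h1 : G.sBdry l 1 (pushChain G.N affineOrd c) = 0 := by
      rw [sBdry_pushChain_affineOrd, hc, map_zero]
    refine ⟨pushChain G.N affineOrd c, h1, ?_⟩
    rw [sTheta_eq_add b hl, h1, map_zero, add_zero, pushChain_straighten_affineOrd]

/-- On chains with affine boundary, integration agrees with that over the straightening. -/
theorem sTheta_eq_of_affine_bdry {c : G.SChain l 2} {d : G.UChain l 1}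
    (h : G.sBdry l 1 c = pushChain G.N affineOrd d) :
    G.sTheta l b c = G.uTheta l (pushChain G.N (straighten b hl) c) := by
  rw [sTheta_eq_add b hl, h, evalChain_pushChain]
  have h0 : (fun s : OrdSimplex (G.lattice l) 1 =>
      contractForm b (edgeDefect b hl (affineOrd s))) = fun _ => 0 := by
    ext s n
    induction s using Quotient.inductionOn with
    | h u =>
      -- Extensionality has passed from the exterior power to the ambient exterior algebra.
      change ((contractForm b (edgeDefect b hl (G.affine l u)) n : ⋀[ℝ]^3 (G.Coh ℝ)) :
        ExteriorAlgebra ℝ (G.Coh ℝ)) = _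
      rw [edgeDefect_affine, contractForm_zero]
      rfl
  have h1 : evalChain (fun _ : OrdSimplex (G.lattice l) 1 =>
      (0 : G.N →ₗ[ℤ] ⋀[ℝ]^3 (G.Coh ℝ))) = 0 := tensorFree_hom_ext fun n s => by simp
  rw [h0, h1]
  simp

/-- Evaluation maps the universal Ceresa period to the tropical one. -/
theorem mk_evExt_uTheta_eq_sAlpha (hl : ∀ e, 0 < l e) (p : Point (V := V) l) (v : V)
    {S : G.UChain (vars E) 2}
    (hS : G.uBdry (vars E) 1 S = G.uCer (vars E) v) :
    (QuotientAddGroup.mk (G.evExt l (G.uTheta (vars E) S)) : _ ⧸ G.sPeriods l b) =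
      G.sAlpha l b p := by
  have hT := Classical.epsilon_spec (G.exists_sBdry_eq_sCer p)
  rw [sAlpha]
  generalize Classical.epsilon (fun S : G.SChain l 2 => G.sBdry l 1 S = G.sCer l p) = T at hT ⊢
  rw [sCer_eq_pushChain] at hT
  obtain ⟨D, hD, hD'⟩ := G.ordCer_sub_uCer_mem v p
  rw [SetLike.mem_coe, AddMonoidHom.mem_ker] at hD
  rw [QuotientAddGroup.eq, sTheta_eq_of_affine_bdry b hl hT, ← uTheta_evChain,
    sPeriods_eq_uPeriods b hl]
  -- The evaluated filling, the straightened tropical filling and the area-free chain D between the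
  -- two Ceresa cycles close up to a cycle. Since Θ(D) = 0, its period is the difference of the two
  -- values of Θ.
  refine ⟨-G.evChain l 2 S + pushChain G.N (straighten b hl) T - D, ?_, ?_⟩
  · rw [SetLike.mem_coe, AddMonoidHom.mem_ker, map_sub, map_add, map_neg, uBdry_evChain, hS,
      evChain_uCer, uBdry_pushChain_straighten, hT, pushChain_straighten_affineOrd, hD']
    abel
  · rw [map_sub, map_add, map_neg, hD, sub_zero]

end MGraph

end Ceresa

end

/-! ### The proposition. -/

theorem mainTheorem4 {V E : Type*} [Finite V] [Fintype E] (G : Ceresa.MGraph V E)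
    (l : E → ℝ) (hl : ∀ e, 0 < l e) {g : ℕ} (b : Module.Basis (Fin g) ℤ G.H1) :
    (∀ v : V, ∃ S : G.UChain (Ceresa.MGraph.vars E) 2, G.uBdry (Ceresa.MGraph.vars E) 1 S = G.uCer (Ceresa.MGraph.vars E) v) ∧
    (∀ p : Ceresa.MGraph.Point (V := V) l, ∃ S : G.SChain l 2, G.sBdry l 1 S = G.sCer l p) ∧
    ∃ h : (G.uPeriods (Ceresa.MGraph.vars E)).map (G.evExt l) = G.sPeriods l b,
      ∀ (v : V) (p : Ceresa.MGraph.Point (V := V) l),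
        QuotientAddGroup.map (G.uPeriods (Ceresa.MGraph.vars E)) (G.sPeriods l b) (G.evExt l)
            (AddSubgroup.map_le_iff_le_comap.mp h.le) (G.uAlpha (Ceresa.MGraph.vars E) v) = G.sAlpha l b p ∧
        (G.uAlpha (Ceresa.MGraph.vars E) v = 0 → G.sAlpha l b p = 0) := by
  refine ⟨G.exists_uBdry_eq_uCer _, fun p => Ceresa.MGraph.exists_sBdry_eq_sCer p,
    (G.map_uPeriods hl).trans (Ceresa.MGraph.sPeriods_eq_uPeriods b hl).symm, fun v p => ?_⟩
  -- The vanishing statement follows from compatibility of the periods, which is applied to the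
  -- filling chosen in `uAlpha`.
  exact (and_iff_left_of_imp fun h h0 => by rw [← h, h0, map_zero]).mpr
    (Ceresa.MGraph.mk_evExt_uTheta_eq_sAlpha b hl p v
      (Classical.epsilon_spec (G.exists_uBdry_eq_uCer (Ceresa.MGraph.vars E) v)))
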